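/- Let $n_1,n_2,s\ge 1$ be integers, $n=n_1n_2$, $m>0$, $\delta\in(0,1]$, and let $$\mathcal C=\{S_1\times S_2:\ S_1\subseteq\{1,\dots,n_1\},\ S_2\subseteq\{1,\dots,n_2\},\ |S_1|\,|S_2|=s\}$$ be the class of $s$-submatrices. The signal $x\in\mathbb R^{n_1\times n_2}$ has an unknown support $S\in\mathcal C$, with $x_i=\mu$ for $i\in S$ and $x_i=0$ for $i\notin S$, where $\mu>0$ is known. A measurement of the entry $i$ with precision $\Gamma>0$ yields $Y=x_i+\Gamma^{-1/2}W$, where the noise variables $W\sim\mathcal N(0,1)$ of different measurements are independent and each is independent of the past. All measurements below have the same precision $\Gamma$; $\mathbb P_S$ and $\mathbb E_S$ denote probability and expectation when the support is $S$. *Tests.* The sequential likelihood ratio test of the entry $i$ with target error probabilities $(\alpha,\beta)$ measures $x_i$ repeatedly, obtaining $Y_1,Y_2,\dots$, and stops at the first $k$ at which $\bar z_k=\sum_{j\le k}\log\frac{f_1(Y_j)}{f_0(Y_j)}$ is not in the interval $\big(\log\frac{\beta}{1-\alpha},\ \log\frac{1-\beta}{\alpha}\big)$, where $f_0,f_1$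 are the densities of $\mathcal N(0,\Gamma^{-1})$ and $\mathcal N(\mu,\Gamma^{-1})$. Its result is $1$ (the entry is declared nonzero) if then $\bar z_k\ge\log\frac{1-\beta}{\alpha}$, and $0$ otherwise. *Procedure.* No entry is queried more than once, and each queried entry is tested. In the search phase, entries are drawn uniformly at random among those not yet queried, until one is declared nonzero or $J=\lceil\frac ns\log\frac2\delta\rceil$ queries have been made (or no entry is left). If an entry was declared nonzero, the refinement phase queries the entries not yet queried in the row and in the column of the first entry declared nonzero; each of these queries is drawn uniformly at random from a nonempty set of such entries, chosen by an arbitrary fixed rule from the queries and results so far (for instance all of them, or a single one). The tests use $\alpha=\delta/(8n)$ throughout, $\beta=\delta/4$ in the search phase and $\beta=\delta/(8s)$ in the refinement phase. The procedure stops as soon as at least one test has been made and at most one set in $\mathcal C$ agrees with all test results, or when the two phases leave nothing to query. The estimator $\hat S$ is the unique set in $\mathcal C$ that agrees with all test results, and $\hat S=\emptyset$ if there is no such set or more than one. Suppose that $$\mu\ \ge\ \sqrt{\frac{2n}{sm}\Big(\log\frac4\delta\Big)^2+\frac{2s}{m}\log\frac{8n}{\delta}+\frac{2(n_1+n_2)}{m}\log\frac{8s}{\delta}}\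 .$$ Then for every sufficiently small $\Gamma>0$ (the threshold depending only on $n_1,n_2,s,m,\mu,\delta$) the procedure satisfies $$\max_{S\in\mathcal C}\mathbb P_S(\hat S\ne S)\le\delta$$ and the precision budget: for every $S\in\mathcal C$, the expected sum of the precisions $\Gamma_j$ of all the measurements made satisfies $\mathbb E_S\big(\sum_j\Gamma_j\big)\le m$. -/

import Mathlib

open MeasureTheory ProbabilityTheory

noncomputable section

namespace SubmatrixSensing

/-- Positions of an `n₁ × n₂` matrix. -/
abbrev Entry (n₁ n₂ : ℕ) : Type := Fin n₁ × Fin n₂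

/-- Completed tests `(Q₁, Ψ₁), (Q₂, Ψ₂), …` in chronological order: the queried entry and the
result of the test (`true` means "declared nonzero"). -/
abbrev History (n₁ n₂ : ℕ) : Type := List (Entry n₁ n₂ × Bool)

/-- The class of all `s`-submatrices: products `S₁ × S₂` with `|S₁| * |S₂| = s`. -/
def submatrices (n₁ n₂ s : ℕ) : Set (Finset (Entry n₁ n₂)) :=
  {S | ∃ (S₁ : Finset (Fin n₁)) (S₂ : Finset (Fin n₂)), S₁.card * S₂.card = s ∧ S = S₁ ×ˢ S₂}

/-- The signal with support `S`: value `μ` on `S` and `0` elsewhere. -/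
def signal {n₁ n₂ : ℕ} (μ : ℝ) (S : Finset (Entry n₁ n₂)) (i : Entry n₁ n₂) : ℝ :=
  if i ∈ S then μ else 0

/-! ### The sequential likelihood ratio test -/

/-- Log-likelihood ratio of the first `k` observations, for `N(μ, 1/Γ)` against `N(0, 1/Γ)`. -/
def logLikelihoodRatio (μ Γ : ℝ) (y : ℕ → ℝ) (k : ℕ) : ℝ :=
  ∑ j ∈ Finset.range k, Real.log
    (gaussianPDFReal μ (Real.toNNReal Γ⁻¹) (y j) / gaussianPDFReal 0 (Real.toNNReal Γ⁻¹) (y j))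

/-- Lower stopping boundary for target error probabilities `α` (type I) and `β` (type II). -/
def lowerBoundary (α β : ℝ) : ℝ := Real.log (β / (1 - α))

/-- Upper stopping boundary for target error probabilities `α` (type I) and `β` (type II). -/
def upperBoundary (α β : ℝ) : ℝ := Real.log ((1 - β) / α)

/-- Number of observations the test takes: the first `k` for which the log-likelihood ratio is
outside the open interval between the boundaries (`⊤` if there is none). -/
def slrtTime (μ Γ α β : ℝ) (y : ℕ → ℝ) : ℕ∞ :=
  ⨅ (k : ℕ) (_ : logLikelihoodRatio μ Γ y k ∉
    Set.Ioo (lowerBoundary α β) (upperBoundary α β)), (k : ℕ∞)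

open Classical in
/-- Result of the test: `true` if the log-likelihood ratio is at or above the upper boundary when
the test stops, `false` otherwise. -/
def slrtDecision (μ Γ α β : ℝ) (y : ℕ → ℝ) : Bool :=
  decide (upperBoundary α β ≤ logLikelihoodRatio μ Γ y (slrtTime μ Γ α β y).toNat)

/-! ### The noiseless procedure -/

/-- The support set `S'` agrees with all test results. -/
def Consistent {n₁ n₂ : ℕ} (h : History n₁ n₂) (S' : Finset (Entry n₁ n₂)) : Prop :=
  ∀ p ∈ h, p.2 = decide (p.1 ∈ S')

/-- At most one `s`-submatrix agrees with all test results. -/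
def Determined {n₁ n₂ : ℕ} (s : ℕ) (h : History n₁ n₂) : Prop :=
  {S' ∈ submatrices n₁ n₂ s | Consistent h S'}.Subsingleton

open Classical in
/-- The unique `s`-submatrix that agrees with all test results, and `∅` if there is no such
submatrix or more than one. -/
def estimator {n₁ n₂ : ℕ} (s : ℕ) (h : History n₁ n₂) : Finset (Entry n₁ n₂) :=
  if H : ∃! S', S' ∈ submatrices n₁ n₂ s ∧ Consistent h S' then H.choose else ∅

/-- The first entry that was declared nonzero, if any. It ends the search phase. -/
def pivot {n₁ n₂ : ℕ} (h : History n₁ n₂) : Option (Entry n₁ n₂) :=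
  (h.find? fun p => p.2).map Prod.fst

/-- Entries that were not queried yet. -/
def unqueried {n₁ n₂ : ℕ} (h : History n₁ n₂) : Finset (Entry n₁ n₂) :=
  Finset.univ \ (h.map Prod.fst).toFinset

/-- All entries in the row or in the column of `q`. -/
def cross {n₁ n₂ : ℕ} (q : Entry n₁ n₂) : Finset (Entry n₁ n₂) :=
  Finset.univ.filter fun i => i.1 = q.1 ∨ i.2 = q.2

/-- Maximal number of queries of the search phase, `(n / s) log (2 / δ)` rounded up, for
`n = n₁ n₂`. -/
def searchLength (n₁ n₂ s : ℕ) (δ : ℝ) : ℕ :=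
  ⌈((n₁ * n₂ : ℕ) : ℝ) / (s : ℝ) * Real.log (2 / δ)⌉₊

/-- A rule for the order in which the row and the column are explored. Given the history and the
set `R` of the entries that can be queried next, it returns a nonempty subset of `R`, from which
the next entry is drawn uniformly at random. So `fun _ R => R` explores in a uniformly random
order, and a rule whose values are singletons explores in a prescribed order. -/
def IsExplorationRule {n₁ n₂ : ℕ}
    (rule : History n₁ n₂ → Finset (Entry n₁ n₂) → Finset (Entry n₁ n₂)) : Prop :=
  ∀ h R, R.Nonempty → (rule h R).Nonempty ∧ rule h R ⊆ R

/-- The set from which the next query is drawn uniformly at random. In the search phase (nothing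
was declared nonzero so far) it consists of all entries that were not queried yet, unless the
maximal number of queries has been made; then it is empty. In the refinement phase it is chosen by
the rule among the entries in the row and column of the pivot that were not queried yet. -/
def candidates {n₁ n₂ : ℕ} (s : ℕ) (δ : ℝ)
    (rule : History n₁ n₂ → Finset (Entry n₁ n₂) → Finset (Entry n₁ n₂))
    (h : History n₁ n₂) : Finset (Entry n₁ n₂) :=
  match pivot h with
  | none => if h.length < searchLength n₁ n₂ s δ then unqueried h else ∅
  | some q => if (unqueried h ∩ cross q).Nonempty then rule h (unqueried h ∩ cross q) else ∅

/-- The procedure stops after the tests in `h`: either at least one test has been made and at most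
one `s`-submatrix agrees with all results, or there is nothing left to query. -/
def Finished {n₁ n₂ : ℕ} (s : ℕ) (δ : ℝ)
    (rule : History n₁ n₂ → Finset (Entry n₁ n₂) → Finset (Entry n₁ n₂))
    (h : History n₁ n₂) : Prop :=
  (h ≠ [] ∧ Determined s h) ∨ candidates s δ rule h = ∅

/-! ### The noisy procedure -/

/-- Type I error probability of all tests. -/
def typeI (n₁ n₂ : ℕ) (δ : ℝ) : ℝ := δ / (8 * ((n₁ * n₂ : ℕ) : ℝ))

/-- Type II error probability of the test that follows the history `h`: one value for the search
phase, another for the refinement phase. -/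
def typeII {n₁ n₂ : ℕ} (s : ℕ) (δ : ℝ) (h : History n₁ n₂) : ℝ :=
  match pivot h with
  | none => δ / 4
  | some _ => δ / (8 * (s : ℝ))

/-- The randomness available to one test: a random element `ξ R` of every nonempty set `R` of
entries, which is used to draw the query, and a sequence of noise variables. -/
abbrev Step (n₁ n₂ : ℕ) : Type :=
  ({R : Finset (Entry n₁ n₂) // R.Nonempty} → Entry n₁ n₂) × (ℕ → ℝ)

/-- `ξ R` is uniformly distributed on `R`, the noise variables are standard normal, and all are
independent. -/
def stepLaw (n₁ n₂ : ℕ) : Measure (Step n₁ n₂) :=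
  (Measure.pi fun R : {R : Finset (Entry n₁ n₂) // R.Nonempty} =>
    (PMF.uniformOfFinset R.1 R.2).toMeasure).prod
  (Measure.infinitePi fun _ : ℕ => gaussianReal 0 1)

instance (n₁ n₂ : ℕ) : IsProbabilityMeasure (stepLaw n₁ n₂) := by
  unfold stepLaw; infer_instance

/-- The underlying probability measure: the tests use independent randomness. -/
def law (n₁ n₂ : ℕ) : Measure (ℕ → Step n₁ n₂) :=
  Measure.infinitePi fun _ : ℕ => stepLaw n₁ n₂

instance (n₁ n₂ : ℕ) : IsProbabilityMeasure (law n₁ n₂) := by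
  unfold law; infer_instance

/-- Measurements of the entry `q` with precision `Γ`: its value plus noise of variance `1 / Γ`. -/
def observations {n₁ n₂ : ℕ} (μ Γ : ℝ) (S : Finset (Entry n₁ n₂)) (q : Entry n₁ n₂)
    (w : ℕ → ℝ) (k : ℕ) : ℝ :=
  signal μ S q + w k / √Γ

open Classical in
/-- The tests completed after `t` steps, when the support of the signal is `S`. As long as the
procedure is not finished, each step draws a query and performs a test of the queried entry. -/
def history {n₁ n₂ : ℕ} (s : ℕ) (δ μ Γ : ℝ)
    (rule : History n₁ n₂ → Finset (Entry n₁ n₂) → Finset (Entry n₁ n₂))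
    (S : Finset (Entry n₁ n₂)) (ω : ℕ → Step n₁ n₂) : ℕ → History n₁ n₂
  | 0 => []
  | t + 1 =>
    let h := history s δ μ Γ rule S ω t
    if H : Finished s δ rule h then h
    else
      let q := (ω t).1 ⟨candidates s δ rule h,
        Finset.nonempty_iff_ne_empty.2 fun e => H (Or.inr e)⟩
      h ++ [(q, slrtDecision μ Γ (typeI n₁ n₂ δ) (typeII s δ h)
        (observations μ Γ S q (ω t).2))]

open Classical in
/-- The number of measurements in the test made in step `t + 1` (`0` if the procedure is already
finished). -/
def measurementCount {n₁ n₂ : ℕ} (s : ℕ) (δ μ Γ : ℝ)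
    (rule : History n₁ n₂ → Finset (Entry n₁ n₂) → Finset (Entry n₁ n₂))
    (S : Finset (Entry n₁ n₂)) (ω : ℕ → Step n₁ n₂) (t : ℕ) : ℕ∞ :=
  let h := history s δ μ Γ rule S ω t
  if H : Finished s δ rule h then 0
  else
    let q := (ω t).1 ⟨candidates s δ rule h,
      Finset.nonempty_iff_ne_empty.2 fun e => H (Or.inr e)⟩
    slrtTime μ Γ (typeI n₁ n₂ δ) (typeII s δ h) (observations μ Γ S q (ω t).2)

/-- The number of tests made by the procedure. -/
def stoppingTime {n₁ n₂ : ℕ} (s : ℕ) (δ μ Γ : ℝ)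
    (rule : History n₁ n₂ → Finset (Entry n₁ n₂) → Finset (Entry n₁ n₂))
    (S : Finset (Entry n₁ n₂)) (ω : ℕ → Step n₁ n₂) : ℕ :=
  sInf {t | Finished s δ rule (history s δ μ Γ rule S ω t)}

/-- The estimate of the support that the procedure returns. -/
def estimate {n₁ n₂ : ℕ} (s : ℕ) (δ μ Γ : ℝ)
    (rule : History n₁ n₂ → Finset (Entry n₁ n₂) → Finset (Entry n₁ n₂))
    (S : Finset (Entry n₁ n₂)) (ω : ℕ → Step n₁ n₂) : Finset (Entry n₁ n₂) :=
  estimator s (history s δ μ Γ rule S ω (stoppingTime s δ μ Γ rule S ω))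

/-- The total precision used: `Γ` for each measurement of each test. -/
def totalPrecision {n₁ n₂ : ℕ} (s : ℕ) (δ μ Γ : ℝ)
    (rule : History n₁ n₂ → Finset (Entry n₁ n₂) → Finset (Entry n₁ n₂))
    (S : Finset (Entry n₁ n₂)) (ω : ℕ → Step n₁ n₂) : ENNReal :=
  ∑ t ∈ Finset.range (stoppingTime s δ μ Γ rule S ω),
    ENNReal.ofReal Γ * (measurementCount s δ μ Γ rule S ω t : ENNReal)

end SubmatrixSensing

end

/-! One device carries the whole proof. Let a state evolve by `F ω (t + 1) = g (F ω t) (ω t)` with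
i.i.d. innovations, and let `φ ≥ 0` satisfy: running cost plus `φ` after one step is at most `φ`
before it, in mean. Then `φ` at the initial state bounds the total expected cost
(`lintegral_tsum_le_of_potential`) and the mean of `φ` at every later time
(`lintegral_le_of_potential`). It is applied to the likelihood walk of a single test and to the
history of the procedure.

Single test. With `c = √Γ * μ`, the log-likelihood ratio of a zero entry is a walk with increments
`c * w - c ^ 2 / 2`: the mean is `-c ^ 2 / 2` and the exponential has mean 1. Without undershoot at
the lower boundary `A`, optional stopping would give Wald's values: upper exit probability at most
`(1 - exp A) / (exp B - exp A) = α` and `c ^ 2 / 2 * E τ ≤ -A`. Overshoot at `B` does no harm. An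
undershoot by more than `ε` is paid for by a fourth moment, `O(c ^ 4)` per step, which the drift `c
^ 2 / 2` absorbs as `Γ → 0`. A nonzero entry is the mirror image, with `α` and `β` exchanged. This
yields `exists_slrt_bounds`.

Procedure, error (`lintegral_errorPotential_step`). While all results are correct, the potential is
a union bound over the future: the chance of drawing only zeros for the rest of the search, plus one
error probability for each test that may still occur. After a wrong result it is 1. Without errors,
the explored row and column of the pivot determine the support.

Procedure, precision (`lintegral_precision_add_potential_step`). Drawing without replacement from
`u` zeros and `v` ones meets `u / (v + 1)` zeros on average before the first one. Missing a one with
probability at most `b₁` inflates this by at most `(1 - b₁)⁻¹`. All ones, and all zeros in one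
cross, are charged in addition.

At the empty history the error potential is at most `δ / 2 + δ / 8 + δ / 4 + δ / 8`, and the
precision potential is at most `m` by the assumption on `μ`. -/

namespace SubmatrixSensing

/-! ### Recursions driven by i.i.d. innovations, and potentials -/

section Chain

variable {X H : Type*} [MeasurableSpace X] [MeasurableSpace H]
  {g : H → X → H} {F : (ℕ → X) → ℕ → H} {h₀ : H}

/-- The state at time `t` is a measurable function of the first `t` coordinates. -/
theorem exists_measurable_restrict_of_recursion
    (hg : Measurable (Function.uncurry g)) (hF₀ : ∀ ω, F ω 0 = h₀)
    (hF : ∀ ω t, F ω (t + 1) = g (F ω t) (ω t)) (t : ℕ) :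
    ∃ G : (Finset.range t → X) → H, Measurable G ∧ ∀ ω, F ω t = G fun i => ω i := by
  induction t with
  | zero => exact ⟨fun _ => h₀, measurable_const, hF₀⟩
  | succ t ih =>
    obtain ⟨G, hG, hGF⟩ := ih
    refine ⟨fun x => g (G fun i => x ⟨i, Finset.mem_range.2
      ((Finset.mem_range.1 i.2).trans t.lt_succ_self)⟩) (x ⟨t, by simp⟩), ?_, ?_⟩
    · refine hg.comp (Measurable.prodMk (hG.comp ?_) (measurable_pi_apply _))
      exact measurable_pi_lambda _ fun i => measurable_pi_apply _
    · intro ω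
      rw [hF, hGF]

theorem measurable_of_recursion
    (hg : Measurable (Function.uncurry g)) (hF₀ : ∀ ω, F ω 0 = h₀)
    (hF : ∀ ω t, F ω (t + 1) = g (F ω t) (ω t)) (t : ℕ) :
    Measurable fun ω => F ω t := by
  obtain ⟨G, hG, hGF⟩ := exists_measurable_restrict_of_recursion hg hF₀ hF t
  simp_rw [hGF]
  exact hG.comp (measurable_pi_lambda _ fun i => measurable_pi_apply _)

/-- The state at time `t` is independent of the randomness used at time `t`. -/
theorem lintegral_state_innovation (P : Measure X) [IsProbabilityMeasure P]
    (hg : Measurable (Function.uncurry g)) (hF₀ : ∀ ω, F ω 0 = h₀)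
    (hF : ∀ ω t, F ω (t + 1) = g (F ω t) (ω t)) {f : H → X → ENNReal}
    (hf : Measurable (Function.uncurry f)) (t : ℕ) :
    ∫⁻ ω, f (F ω t) (ω t) ∂(Measure.infinitePi fun _ : ℕ => P) =
      ∫⁻ ω, ∫⁻ x, f (F ω t) x ∂P ∂(Measure.infinitePi fun _ : ℕ => P) := by
  have hFm := measurable_of_recursion hg hF₀ hF t
  obtain ⟨G, hG, hGF⟩ := exists_measurable_restrict_of_recursion hg hF₀ hF t
  have hind : IndepFun (fun ω => F ω t) (fun ω : ℕ → X => ω t)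
      (Measure.infinitePi fun _ : ℕ => P) := by
    have h1 : iIndepFun (fun i (ω : ℕ → X) => ω i) (Measure.infinitePi fun _ : ℕ => P) :=
      iIndepFun_infinitePi (P := fun _ : ℕ => P) (X := fun _ x => x) fun _ => measurable_id
    have h2 := h1.indepFun_finset (Finset.range t) {t} (by simp) fun i => measurable_pi_apply i
    have h3 := h2.comp hG
      (measurable_pi_apply (X := fun _ : ({t} : Finset ℕ) => X) ⟨t, by simp⟩)
    have h4 : (fun ω => F ω t) = G ∘ fun a (i : Finset.range t) => a i := funext hGF
    rw [h4]
    exact h3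
  have hmap := (indepFun_iff_map_prod_eq_prod_map_map hFm.aemeasurable
    (measurable_pi_apply t).aemeasurable).1 hind
  calc ∫⁻ ω, f (F ω t) (ω t) ∂(Measure.infinitePi fun _ : ℕ => P)
      = ∫⁻ p, Function.uncurry f p
          ∂((Measure.infinitePi fun _ : ℕ => P).map fun ω => (F ω t, ω t)) := by
        rw [lintegral_map hf (hFm.prodMk (measurable_pi_apply t))]; rfl
    _ = ∫⁻ h, ∫⁻ x, f h x ∂P ∂((Measure.infinitePi fun _ : ℕ => P).map fun ω => F ω t) := by
        rw [hmap, (measurePreserving_eval_infinitePi (fun _ : ℕ => P) t).map_eq,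
          lintegral_prod _ hf.aemeasurable]; rfl
    _ = _ := by
        exact lintegral_map hf.lintegral_prod_right' hFm

/-- If `φ` is a potential for the running cost `c`, it bounds the total expected cost. -/
theorem sum_lintegral_add_lintegral_le (P : Measure X) [IsProbabilityMeasure P]
    (hg : Measurable (Function.uncurry g)) (hF₀ : ∀ ω, F ω 0 = h₀)
    (hF : ∀ ω t, F ω (t + 1) = g (F ω t) (ω t)) {c : H → X → ENNReal}
    (hc : Measurable (Function.uncurry c)) {φ : H → ENNReal} (hφ : Measurable φ)
    (hstep : ∀ h, ∫⁻ x, (c h x + φ (g h x)) ∂P ≤ φ h) (T : ℕ) :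
    ∑ t ∈ Finset.range T, ∫⁻ ω, c (F ω t) (ω t) ∂(Measure.infinitePi fun _ : ℕ => P) +
      ∫⁻ ω, φ (F ω T) ∂(Measure.infinitePi fun _ : ℕ => P) ≤ φ h₀ := by
  induction T with
  | zero => simp [hF₀]
  | succ T ih =>
    refine le_trans ?_ ih
    rw [Finset.sum_range_succ, add_assoc]
    gcongr
    have hFm := measurable_of_recursion hg hF₀ hF T
    have hm : Measurable (Function.uncurry fun h x => c h x + φ (g h x)) :=
      hc.add (hφ.comp hg)
    calc _ = ∫⁻ ω, (c (F ω T) (ω T) + φ (g (F ω T) (ω T)))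
            ∂(Measure.infinitePi fun _ : ℕ => P) := by
          simp_rw [hF]
          exact (lintegral_add_left (hc.comp (hFm.prodMk (measurable_pi_apply T))) _).symm
      _ = _ := lintegral_state_innovation P hg hF₀ hF hm T
      _ ≤ _ := lintegral_mono fun ω => hstep _

theorem lintegral_tsum_le_of_potential (P : Measure X) [IsProbabilityMeasure P]
    (hg : Measurable (Function.uncurry g)) (hF₀ : ∀ ω, F ω 0 = h₀)
    (hF : ∀ ω t, F ω (t + 1) = g (F ω t) (ω t)) {c : H → X → ENNReal}
    (hc : Measurable (Function.uncurry c)) {φ : H → ENNReal} (hφ : Measurable φ)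
    (hstep : ∀ h, ∫⁻ x, (c h x + φ (g h x)) ∂P ≤ φ h) :
    ∫⁻ ω, ∑' t, c (F ω t) (ω t) ∂(Measure.infinitePi fun _ : ℕ => P) ≤ φ h₀ := by
  have hm (t : ℕ) : Measurable fun ω => c (F ω t) (ω t) :=
    hc.comp ((measurable_of_recursion hg hF₀ hF t).prodMk (measurable_pi_apply t))
  rw [lintegral_tsum fun t => (hm t).aemeasurable]
  exact ENNReal.tsum_le_of_sum_range_le fun T =>
    le_self_add.trans (sum_lintegral_add_lintegral_le P hg hF₀ hF hc hφ hstep T)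

theorem lintegral_le_of_potential (P : Measure X) [IsProbabilityMeasure P]
    (hg : Measurable (Function.uncurry g)) (hF₀ : ∀ ω, F ω 0 = h₀)
    (hF : ∀ ω t, F ω (t + 1) = g (F ω t) (ω t)) {φ : H → ENNReal} (hφ : Measurable φ)
    (hstep : ∀ h, ∫⁻ x, φ (g h x) ∂P ≤ φ h) (T : ℕ) :
    ∫⁻ ω, φ (F ω T) ∂(Measure.infinitePi fun _ : ℕ => P) ≤ φ h₀ :=
  le_add_self.trans (sum_lintegral_add_lintegral_le P hg hF₀ hF (c := fun _ _ => 0)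
    measurable_const hφ (by simpa using hstep) T)

end Chain

/-! ### Stopped walks -/

/-- First time at which the sequence `W` is outside the interval `(A, B)`. -/
noncomputable def exitTime (A B : ℝ) (W : ℕ → ℝ) : ℕ∞ :=
  ⨅ (k : ℕ) (_ : W k ∉ Set.Ioo A B), (k : ℕ∞)

open Classical in
/-- One step of a walk that is frozen when it is outside the interval `(A, B)`. -/
noncomputable def frozenStep (A B z u : ℝ) : ℝ := if z ∈ Set.Ioo A B then z + u else z

/-- The walk with increments `u`, frozen when it leaves the interval `(A, B)`. -/
noncomputable def stoppedWalk (A B : ℝ) (u : ℕ → ℝ) : ℕ → ℝ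
  | 0 => 0
  | k + 1 => frozenStep A B (stoppedWalk A B u k) (u k)

theorem exitTime_eq_top_or (A B : ℝ) (W : ℕ → ℝ) :
    (exitTime A B W = ⊤ ∧ ∀ k, W k ∈ Set.Ioo A B) ∨
      ∃ τ : ℕ, exitTime A B W = τ ∧ W τ ∉ Set.Ioo A B ∧ ∀ j < τ, W j ∈ Set.Ioo A B := by
  classical
  by_cases h : ∃ k, W k ∉ Set.Ioo A B
  · refine Or.inr ⟨Nat.find h, le_antisymm ?_ ?_, Nat.find_spec h, fun j hj => ?_⟩
    · exact iInf₂_le (Nat.find h) (Nat.find_spec h)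
    · exact le_iInf₂ fun k hk => by exact_mod_cast Nat.find_min' h hk
    · exact not_not.1 (Nat.find_min h hj)
  · push Not at h
    refine Or.inl ⟨?_, h⟩
    simp only [exitTime, h, not_true_eq_false, iInf_false, iInf_const]

theorem stoppedWalk_eq_sum {A B : ℝ} {u : ℕ → ℝ} {k : ℕ}
    (h : ∀ j < k, ∑ i ∈ Finset.range j, u i ∈ Set.Ioo A B) :
    stoppedWalk A B u k = ∑ i ∈ Finset.range k, u i := by
  induction k with
  | zero => simp [stoppedWalk]
  | succ k ih =>
    have hk := ih fun j hj => h j (hj.trans k.lt_succ_self)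
    rw [stoppedWalk, hk, frozenStep, if_pos (h k k.lt_succ_self), Finset.sum_range_succ]

theorem stoppedWalk_eq_of_le {A B : ℝ} {u : ℕ → ℝ} {k l : ℕ}
    (h : stoppedWalk A B u k ∉ Set.Ioo A B) (hkl : k ≤ l) :
    stoppedWalk A B u l = stoppedWalk A B u k := by
  induction l, hkl using Nat.le_induction with
  | base => rfl
  | succ l _ ih => rw [stoppedWalk, ih, frozenStep, if_neg h]

/-- The frozen walk is inside the interval exactly at the times before the exit. This turns the exit
time into a total running cost of a chain, as the potential method needs, and also gives its
measurability. -/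
theorem coe_exitTime_eq_tsum (A B : ℝ) (u : ℕ → ℝ) :
    ((exitTime A B fun k => ∑ i ∈ Finset.range k, u i : ℕ∞) : ENNReal) =
      ∑' k, (Set.Ioo A B).indicator 1 (stoppedWalk A B u k) := by
  rcases exitTime_eq_top_or A B fun k => ∑ i ∈ Finset.range k, u i with ⟨h, hk⟩ | ⟨τ, h, hτ, hj⟩
  · have : ∀ k, (Set.Ioo A B).indicator (1 : ℝ → ENNReal) (stoppedWalk A B u k) = 1 := fun k => by
      rw [stoppedWalk_eq_sum fun j _ => hk j, Set.indicator_of_mem (hk k), Pi.one_apply]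
    simp [h, this]
  · have h1 : stoppedWalk A B u τ ∉ Set.Ioo A B := by rwa [stoppedWalk_eq_sum hj]
    rw [h, tsum_eq_sum (s := Finset.range τ)]
    · rw [Finset.sum_congr rfl (g := fun _ => 1)]
      · simp
      · intro k hk
        rw [Finset.mem_range] at hk
        rw [stoppedWalk_eq_sum fun j hjk => hj j (hjk.trans hk), Set.indicator_of_mem (hj k hk),
          Pi.one_apply]
    · intro k hk
      rw [Finset.mem_range, not_lt] at hk
      rw [stoppedWalk_eq_of_le h1 hk, Set.indicator_of_notMem h1]

/-- If the walk is above the upper boundary when it leaves the interval, so is the frozen walk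
from some time on. -/
theorem exists_le_stoppedWalk {A B : ℝ} {u : ℕ → ℝ} {τ : ℕ}
    (hτ : exitTime A B (fun k => ∑ i ∈ Finset.range k, u i) = τ)
    (hB : B ≤ ∑ i ∈ Finset.range τ, u i) : ∃ k, B ≤ stoppedWalk A B u k := by
  rcases exitTime_eq_top_or A B fun k => ∑ i ∈ Finset.range k, u i with ⟨h, -⟩ | ⟨σ, h, -, hj⟩
  · simp [h] at hτ
  · rw [h] at hτ
    obtain rfl : σ = τ := by exact_mod_cast hτ
    exact ⟨σ, by rwa [stoppedWalk_eq_sum hj]⟩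

/-- The right side is how the test decides. If the walk never exits, `toNat ⊤ = 0` makes it look at
the empty sum, and `0 < B` ensures that both sides are then false. -/
theorem exists_stoppedWalk_iff {A B : ℝ} {u : ℕ → ℝ} (hB : 0 < B) :
    (∃ k, B ≤ stoppedWalk A B u k) ↔ B ≤ ∑ i ∈ Finset.range
      (exitTime A B fun k => ∑ i ∈ Finset.range k, u i).toNat, u i := by
  rcases exitTime_eq_top_or A B fun k => ∑ i ∈ Finset.range k, u i with ⟨h, hk⟩ | ⟨τ, h, hτ, hj⟩
  · simp only [h, ENat.toNat_top, Finset.range_zero, Finset.sum_empty, hB.not_ge, iff_false,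
      not_exists, not_le]
    intro k
    rw [stoppedWalk_eq_sum fun j _ => hk j]
    exact (hk k).2
  · simp only [h, ENat.toNat_natCast]
    refine ⟨fun ⟨k, hk⟩ => ?_, exists_le_stoppedWalk h⟩
    rcases lt_or_ge k τ with hkτ | hkτ
    · rw [stoppedWalk_eq_sum fun j hjk => hj j (hjk.trans hkτ)] at hk
      exact absurd hk (hj k hkτ).2.not_ge
    · have h1 : stoppedWalk A B u τ ∉ Set.Ioo A B := by rwa [stoppedWalk_eq_sum hj]
      rwa [stoppedWalk_eq_of_le h1 hkτ, stoppedWalk_eq_sum hj] at hk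

theorem exitTime_neg (A B : ℝ) (W : ℕ → ℝ) :
    exitTime (-B) (-A) (fun k => -W k) = exitTime A B W := by
  have (k : ℕ) : -W k ∈ Set.Ioo (-B) (-A) ↔ W k ∈ Set.Ioo A B := by
    simp only [Set.mem_Ioo, neg_lt_neg_iff]; tauto
  simp only [exitTime, this]

@[fun_prop]
theorem measurable_frozenStep (A B : ℝ) :
    Measurable fun p : ℝ × ℝ => frozenStep A B p.1 p.2 :=
  Measurable.ite (measurable_fst measurableSet_Ioo) (measurable_fst.add measurable_snd)
    measurable_fst

/-! ### Gaussian log-likelihood increments -/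

/-- The increment of the log-likelihood ratio, up to sign, for standard noise `w` and
signal-to-noise ratio `c`. -/
noncomputable def llrIncrement (c w : ℝ) : ℝ := c * w - c ^ 2 / 2

@[fun_prop]
theorem measurable_llrIncrement (c : ℝ) : Measurable (llrIncrement c) := by
  unfold llrIncrement; fun_prop

theorem integrable_llrIncrement (c : ℝ) : Integrable (llrIncrement c) (gaussianReal 0 1) := by
  have h : Integrable (fun x : ℝ => x) (gaussianReal 0 1) :=
    memLp_one_iff_integrable.1 (memLp_id_gaussianReal 1)
  exact (h.const_mul c).sub (integrable_const _)

theorem integral_llrIncrement (c : ℝ) :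
    ∫ w, llrIncrement c w ∂gaussianReal 0 1 = -(c ^ 2 / 2) := by
  have h : Integrable (fun x : ℝ => x) (gaussianReal 0 1) :=
    memLp_one_iff_integrable.1 (memLp_id_gaussianReal 1)
  simp only [llrIncrement]
  rw [integral_sub (h.const_mul c) (integrable_const _), integral_const_mul,
    integral_id_gaussianReal]
  simp

theorem integrable_exp_llrIncrement (c : ℝ) :
    Integrable (fun w => Real.exp (llrIncrement c w)) (gaussianReal 0 1) := by
  simp only [llrIncrement, Real.exp_sub, div_eq_mul_inv]
  exact (integrable_exp_mul_gaussianReal c).mul_const _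

/-- The likelihood ratio is a martingale under the null hypothesis; here it is the Gaussian moment
generating function. -/
theorem integral_exp_llrIncrement (c : ℝ) :
    ∫ w, Real.exp (llrIncrement c w) ∂gaussianReal 0 1 = 1 := by
  have h := congrFun (mgf_fun_id_gaussianReal (μ := 0) (v := 1)) c
  simp only [mgf] at h
  simp only [llrIncrement, Real.exp_sub]
  rw [integral_div, h, ← Real.exp_sub]
  simp

theorem integrable_pow_gaussianReal (k : ℕ) :
    Integrable (fun x : ℝ => x ^ k) (gaussianReal 0 1) := by
  rcases eq_or_ne k 0 with rfl | hk
  · simp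
  · have h := (memLp_id_gaussianReal (μ := 0) (v := 1) k).integrable_norm_pow hk
    refine h.mono' (by fun_prop) (Filter.Eventually.of_forall fun x => ?_)
    simp

theorem llrIncrement_pow_four_le {c : ℝ} (hc : |c| ≤ 1) (w : ℝ) :
    llrIncrement c w ^ 4 ≤ 8 * (w ^ 4 + 1) * c ^ 4 := by
  have h1 : llrIncrement c w ^ 4 = c ^ 4 * (w - c / 2) ^ 4 := by
    rw [llrIncrement]; ring
  have h2 : (w - c / 2) ^ 4 ≤ 8 * (w ^ 4 + (c / 2) ^ 4) := by
    nlinarith [sq_nonneg (w ^ 2 - (c / 2) ^ 2), sq_nonneg (w + c / 2), sq_nonneg (w - c / 2),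
      sq_nonneg ((w + c / 2) ^ 2), sq_nonneg ((w - c / 2) ^ 2),
      mul_nonneg (sq_nonneg (w + c / 2)) (sq_nonneg (w - c / 2)),
      sq_nonneg ((w + c / 2) * (w - c / 2)), sq_nonneg ((w + c / 2) * (w + 3 * c / 2))]
  have h3 : (c / 2) ^ 4 ≤ 1 := by
    have : (c / 2) ^ 4 = |c| ^ 4 / 16 := by
      rw [div_pow, ← abs_pow, abs_of_nonneg (by positivity : 0 ≤ c ^ 4)]; norm_num
    rw [this]
    have := pow_le_one₀ (n := 4) (abs_nonneg c) hc
    linarith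
  rw [h1, mul_comm]
  gcongr
  linarith

theorem integrable_llrIncrement_pow_four {c : ℝ} (hc : |c| ≤ 1) :
    Integrable (fun w => llrIncrement c w ^ 4) (gaussianReal 0 1) := by
  refine Integrable.mono' ((((integrable_pow_gaussianReal 4).add
    (integrable_const 1)).const_mul 8).mul_const (c ^ 4)) (by fun_prop)
    (Filter.Eventually.of_forall fun w => ?_)
  rw [Real.norm_of_nonneg (by positivity)]
  exact llrIncrement_pow_four_le hc w

/-- The point is the order `c ^ 4`, negligible against the drift `c ^ 2 / 2`, with a constant
uniform in `c`. -/
theorem exists_integral_llrIncrement_pow_four_le :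
    ∃ K : ℝ, 0 < K ∧ ∀ c : ℝ, |c| ≤ 1 →
      ∫ w, llrIncrement c w ^ 4 ∂gaussianReal 0 1 ≤ K * c ^ 4 := by
  refine ⟨8 * ((∫ w, w ^ 4 ∂gaussianReal 0 1) + 1), ?_, fun c hc => ?_⟩
  · have : 0 ≤ ∫ w : ℝ, w ^ 4 ∂gaussianReal 0 1 := integral_nonneg fun w => by positivity
    positivity
  · have hi := integrable_pow_gaussianReal 4
    calc _ ≤ ∫ w, 8 * (w ^ 4 + 1) * c ^ 4 ∂gaussianReal 0 1 :=
          integral_mono (integrable_llrIncrement_pow_four hc)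
            (((hi.add (integrable_const 1)).const_mul 8).mul_const _)
            fun w => llrIncrement_pow_four_le hc w
      _ = _ := by
          rw [integral_mul_const, integral_const_mul, integral_add hi (integrable_const 1)]
          simp

/-! ### Potentials for the stopped walk -/

theorem lintegral_ofReal_le_of_le {X : Type*} [MeasurableSpace X] {P : Measure X} {f q : X → ℝ}
    {b : ℝ} (hf : ∀ x, 0 ≤ f x) (hfq : ∀ x, f x ≤ q x) (hq : Integrable q P)
    (hb : ∫ x, q x ∂P ≤ b) : ∫⁻ x, ENNReal.ofReal (f x) ∂P ≤ ENNReal.ofReal b :=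
  calc ∫⁻ x, ENNReal.ofReal (f x) ∂P ≤ ∫⁻ x, ENNReal.ofReal (q x) ∂P :=
        lintegral_mono fun x => ENNReal.ofReal_le_ofReal (hfq x)
    _ = ENNReal.ofReal (∫ x, q x ∂P) :=
        (ofReal_integral_eq_lintegral_ofReal hq
          (Filter.Eventually.of_forall fun x => (hf x).trans (hfq x))).symm
    _ ≤ _ := ENNReal.ofReal_le_ofReal hb

/-- The undershoot of a large step is controlled by the fourth power of the step. -/
theorem max_add_le_add_pow_four {ε y x : ℝ} (hε : 0 < ε) (hy : ε ≤ y) :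
    max (y + x) 0 ≤ y + x + x ^ 4 / ε ^ 3 := by
  have h4 : 0 ≤ x ^ 4 / ε ^ 3 := by positivity
  refine max_le (by linarith) ?_
  by_cases h : 0 ≤ y + x
  · linarith
  -- A negative sum forces a jump of size at least `ε`, and then `|x| ≤ x ^ 4 / ε ^ 3`.
  · have hx : ε ≤ -x := by linarith
    have : -x ≤ x ^ 4 / ε ^ 3 := by
      rw [le_div_iff₀ (by positivity)]
      calc -x * ε ^ 3 ≤ -x * (-x) ^ 3 := by gcongr; linarith
        _ = x ^ 4 := by ring
    linarith

/-- The same for an exponential walk. -/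
theorem max_exp_sub_le_add_pow_four {ε A z x : ℝ} (hε : 0 < ε) (hz : A < z) :
    max (Real.exp (z + x) - Real.exp (A - ε)) 0 ≤
      Real.exp z * Real.exp x - Real.exp (A - ε) + Real.exp A * (x ^ 4 / ε ^ 4) := by
  have h4 : 0 ≤ Real.exp A * (x ^ 4 / ε ^ 4) := by positivity
  rw [← Real.exp_add]
  refine max_le (by linarith) ?_
  by_cases h : A - ε ≤ z + x
  · have := Real.exp_le_exp.2 h
    linarith
  · have hx : ε ≤ -x := by linarith
    have h1 : 1 ≤ x ^ 4 / ε ^ 4 := by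
      rw [le_div_iff₀ (by positivity), one_mul]
      calc ε ^ 4 ≤ (-x) ^ 4 := by gcongr
        _ = x ^ 4 := by ring
    have h2 : Real.exp A * 1 ≤ Real.exp A * (x ^ 4 / ε ^ 4) := by gcongr
    have h3 : Real.exp (A - ε) ≤ Real.exp A := Real.exp_le_exp.2 (by linarith)
    have h5 := Real.exp_pos (z + x)
    linarith

/-- The potential is the positive part of `z - A + ε`. Inside the interval the linear function loses
`c ^ 2 / 2` per step in mean, and taking the positive part gives back at most `K * c ^ 4 / ε ^ 3`,
because the margin `ε` leaves only large jumps to be corrected. The difference pays for one unit of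
time. -/
theorem lintegral_tsum_stoppedWalk_le {A B c ε K : ℝ} (hε : 0 < ε) (hc : |c| ≤ 1)
    (hK : ∫ w, llrIncrement c w ^ 4 ∂gaussianReal 0 1 ≤ K * c ^ 4)
    (hA : A < 0) (hκ : 0 ≤ c ^ 2 / 2 - K * c ^ 4 / ε ^ 3) :
    ENNReal.ofReal (c ^ 2 / 2 - K * c ^ 4 / ε ^ 3) *
      ∫⁻ ω, ∑' k, (Set.Ioo A B).indicator 1 (stoppedWalk A B (fun j => llrIncrement c (ω j)) k)
        ∂(Measure.infinitePi fun _ : ℕ => gaussianReal 0 1) ≤ ENNReal.ofReal (ε - A) := by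
  set κ := c ^ 2 / 2 - K * c ^ 4 / ε ^ 3 with hκd
  have hg : Measurable (Function.uncurry fun z w => frozenStep A B z (llrIncrement c w)) := by
    simp only [Function.uncurry_def]; fun_prop
  have hi : Measurable fun z : ℝ => (Set.Ioo A B).indicator (1 : ℝ → ENNReal) z :=
    measurable_one.indicator measurableSet_Ioo
  have key := lintegral_tsum_le_of_potential (gaussianReal 0 1) (g := fun z w =>
    frozenStep A B z (llrIncrement c w)) (h₀ := 0)
    (F := fun ω k => stoppedWalk A B (fun j => llrIncrement c (ω j)) k) hg
    (fun _ => rfl) (fun _ _ => rfl)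
    (c := fun z _ => ENNReal.ofReal κ * (Set.Ioo A B).indicator 1 z)
    (φ := fun z => ENNReal.ofReal (max (z - A + ε) 0)) ((hi.comp measurable_fst).const_mul _)
    (by fun_prop) ?_
  · have hle : max (0 - A + ε) 0 = ε - A := by rw [max_eq_left] <;> linarith
    rw [hle] at key
    refine le_trans (le_of_eq ?_) key
    rw [← lintegral_const_mul']
    · simp only [ENNReal.tsum_mul_left]
    · simp
  · intro z
    by_cases hz : z ∈ Set.Ioo A B
    · simp only [Set.indicator_of_mem hz, Pi.one_apply, mul_one, frozenStep, if_pos hz]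
      have : ∀ w, ENNReal.ofReal κ + ENNReal.ofReal (max (z + llrIncrement c w - A + ε) 0) =
          ENNReal.ofReal (κ + max (z + llrIncrement c w - A + ε) 0) := fun w =>
        (ENNReal.ofReal_add hκ (le_max_right _ _)).symm
      simp only [this]
      have h1 := integrable_llrIncrement c
      have h2 := integrable_llrIncrement_pow_four hc
      refine lintegral_ofReal_le_of_le (fun w => by positivity)
        (q := fun w => (κ + (z - A + ε)) + (llrIncrement c w + llrIncrement c w ^ 4 / ε ^ 3))
        (fun w => ?_) ?_ ?_
      · have := max_add_le_add_pow_four (x := llrIncrement c w) hε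
          (show ε ≤ z - A + ε by linarith [hz.1])
        have h3 : z + llrIncrement c w - A + ε = z - A + ε + llrIncrement c w := by ring
        rw [h3]
        linarith
      · exact (integrable_const _).add (h1.add (h2.div_const _))
      · have h3 : Integrable (fun w => llrIncrement c w + llrIncrement c w ^ 4 / ε ^ 3)
            (gaussianReal 0 1) := h1.add (h2.div_const _)
        rw [integral_add (integrable_const _) h3, integral_add h1 (h2.div_const _), integral_div, integral_llrIncrement,
          max_eq_left (by linarith [hz.1])]
        have : (∫ w, llrIncrement c w ^ 4 ∂gaussianReal 0 1) / ε ^ 3 ≤ K * c ^ 4 / ε ^ 3 := by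
          gcongr
        simp only [integral_const, probReal_univ, one_smul]
        linarith
    · simp only [Set.indicator_of_notMem hz, frozenStep, if_neg hz, mul_zero, zero_add,
        lintegral_const, measure_univ, mul_one, le_refl]

/-- Potential for the probability that the walk leaves `(A, B)` above. -/
noncomputable def crossingPotential (A D ε lam z : ℝ) : ℝ :=
  max (Real.exp z - Real.exp (A - ε)) 0 / D + lam * max (z - A + ε) 0

/-- The exponential part of the potential is at least 1 above `B` and is a martingale up to a
truncation error of order `c ^ 4`. The linear part, weighted by `lam`, decreases by about `lam * c ^
2 / 2` per step and pays for this error; `hκ` says that it suffices. -/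
theorem measure_le_stoppedWalk_le {A B c ε K lam : ℝ} (hε : 0 < ε) (hc : |c| ≤ 1)
    (hK : ∫ w, llrIncrement c w ^ 4 ∂gaussianReal 0 1 ≤ K * c ^ 4)
    (hAB : A < B) (hlam : 0 ≤ lam)
    (hκ : Real.exp A * (K * c ^ 4 / ε ^ 4) / (Real.exp B - Real.exp (A - ε)) +
      lam * (K * c ^ 4 / ε ^ 3) ≤ lam * (c ^ 2 / 2)) (T : ℕ) :
    (Measure.infinitePi fun _ : ℕ => gaussianReal 0 1)
      {ω | B ≤ stoppedWalk A B (fun j => llrIncrement c (ω j)) T} ≤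
      ENNReal.ofReal (crossingPotential A (Real.exp B - Real.exp (A - ε)) ε lam 0) := by
  set D := Real.exp B - Real.exp (A - ε) with hD
  have hD0 : 0 < D := sub_pos.2 (Real.exp_lt_exp.2 (by linarith))
  have hg : Measurable (Function.uncurry fun z w => frozenStep A B z (llrIncrement c w)) := by
    simp only [Function.uncurry_def]; fun_prop
  have hnn (z : ℝ) : 0 ≤ crossingPotential A D ε lam z := by
    unfold crossingPotential; positivity
  have hm : Measurable fun z => ENNReal.ofReal (crossingPotential A D ε lam z) := by
    unfold crossingPotential; fun_prop
  have hW := measurable_of_recursion (h₀ := 0)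
    (F := fun ω k => stoppedWalk A B (fun j => llrIncrement c (ω j)) k) hg
    (fun _ => rfl) (fun _ _ => rfl) T
  have key := lintegral_le_of_potential (gaussianReal 0 1) (h₀ := 0)
    (F := fun ω k => stoppedWalk A B (fun j => llrIncrement c (ω j)) k) hg
    (fun _ => rfl) (fun _ _ => rfl)
    (φ := fun z => ENNReal.ofReal (crossingPotential A D ε lam z)) hm ?_ T
  · refine le_trans ?_ key
    rw [← lintegral_indicator_one (measurableSet_le measurable_const hW)]
    refine lintegral_mono fun ω => Set.indicator_apply_le' (fun hω => ?_) fun _ => zero_le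
    rw [Pi.one_apply, ← ENNReal.ofReal_one]
    refine ENNReal.ofReal_le_ofReal ?_
    have h1 : 1 ≤ max (Real.exp (stoppedWalk A B (fun j => llrIncrement c (ω j)) T) -
        Real.exp (A - ε)) 0 / D := by
      rw [le_div_iff₀ hD0, one_mul, hD]
      exact le_max_of_le_left (sub_le_sub_right (Real.exp_le_exp.2 hω) _)
    exact h1.trans (le_add_of_nonneg_right (by positivity))
  · intro z
    by_cases hz : z ∈ Set.Ioo A B
    · simp only [frozenStep, if_pos hz]
      have h1 := integrable_llrIncrement c
      have h2 := integrable_llrIncrement_pow_four hc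
      have h3 := integrable_exp_llrIncrement c
      have i1 : Integrable (fun w => (Real.exp z * Real.exp (llrIncrement c w) - Real.exp (A - ε) +
          Real.exp A * (llrIncrement c w ^ 4 / ε ^ 4)) / D) (gaussianReal 0 1) :=
        (((h3.const_mul _).sub (integrable_const _)).add ((h2.div_const _).const_mul _)).div_const _
      have i2 : Integrable (fun w => lam * (z - A + ε + llrIncrement c w +
          llrIncrement c w ^ 4 / ε ^ 3)) (gaussianReal 0 1) :=
        (((integrable_const _).add h1).add (h2.div_const _)).const_mul _
      refine lintegral_ofReal_le_of_le (fun w => hnn _) (fun w => ?_) (i1.add i2) ?_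
      · have h3 : z + llrIncrement c w - A + ε = z - A + ε + llrIncrement c w := by ring
        rw [crossingPotential, h3]
        exact add_le_add (div_le_div_of_nonneg_right (max_exp_sub_le_add_pow_four hε hz.1) hD0.le)
          (mul_le_mul_of_nonneg_left (max_add_le_add_pow_four hε (by linarith [hz.1])) hlam)
      · have e1 : ∫ w, (Real.exp z * Real.exp (llrIncrement c w) - Real.exp (A - ε) +
            Real.exp A * (llrIncrement c w ^ 4 / ε ^ 4)) / D ∂gaussianReal 0 1 =
            (Real.exp z - Real.exp (A - ε) + Real.exp A *
              ((∫ w, llrIncrement c w ^ 4 ∂gaussianReal 0 1) / ε ^ 4)) / D := by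
          have h4 : Integrable (fun w => Real.exp z * Real.exp (llrIncrement c w) -
              Real.exp (A - ε)) (gaussianReal 0 1) := (h3.const_mul _).sub (integrable_const _)
          rw [integral_div, integral_add h4 ((h2.div_const _).const_mul _), integral_sub (h3.const_mul _) (integrable_const _),
            integral_const_mul, integral_const_mul, integral_div, integral_exp_llrIncrement]
          simp
        have e2 : ∫ w, lam * (z - A + ε + llrIncrement c w + llrIncrement c w ^ 4 / ε ^ 3)
            ∂gaussianReal 0 1 = lam * (z - A + ε - c ^ 2 / 2 +
              (∫ w, llrIncrement c w ^ 4 ∂gaussianReal 0 1) / ε ^ 3) := by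
          have h4 : Integrable (fun w => z - A + ε + llrIncrement c w) (gaussianReal 0 1) :=
            (integrable_const _).add h1
          rw [integral_const_mul, integral_add h4 (h2.div_const _),
            integral_add (integrable_const _) h1, integral_div, integral_llrIncrement]
          simp only [integral_const, probReal_univ, one_smul]
          ring
        rw [integral_add' i1 i2, e1, e2, crossingPotential, max_eq_left, max_eq_left]
        · have j1 : Real.exp A * ((∫ w, llrIncrement c w ^ 4 ∂gaussianReal 0 1) / ε ^ 4) / D ≤
              Real.exp A * (K * c ^ 4 / ε ^ 4) / D := by gcongr
          have j2 : lam * ((∫ w, llrIncrement c w ^ 4 ∂gaussianReal 0 1) / ε ^ 3) ≤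
              lam * (K * c ^ 4 / ε ^ 3) := by gcongr
          rw [add_div, mul_add, mul_sub]
          linarith
        · linarith [hz.1]
        · exact sub_nonneg.2 (Real.exp_le_exp.2 (by linarith [hz.1]))
    · simp only [frozenStep, if_neg hz, lintegral_const, measure_univ, mul_one, le_refl]

/-! ### Asymptotics for small signal-to-noise ratio -/

/-- Wald's approximations hold up to `η` for small `c`. The order of choice matters: the margin
first, depending on `η` only, then `lam`, and `c` last. -/
theorem exists_stoppedWalk_bounds {A B η : ℝ} (hA : A < 0) (hB : 0 < B) (hη : 0 < η) :
    ∃ c₀ : ℝ, 0 < c₀ ∧ ∀ c : ℝ, c ≠ 0 → |c| ≤ c₀ →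
      (∀ T, (Measure.infinitePi fun _ : ℕ => gaussianReal 0 1)
        {ω | B ≤ stoppedWalk A B (fun j => llrIncrement c (ω j)) T} ≤
        ENNReal.ofReal ((1 - Real.exp A) / (Real.exp B - Real.exp A) + η)) ∧
      ENNReal.ofReal (c ^ 2 / 2) *
      ∫⁻ ω, ∑' k, (Set.Ioo A B).indicator 1 (stoppedWalk A B (fun j => llrIncrement c (ω j)) k)
        ∂(Measure.infinitePi fun _ : ℕ => gaussianReal 0 1) ≤ ENNReal.ofReal (η - A) := by
  obtain ⟨K, hK0, hK⟩ := exists_integral_llrIncrement_pow_four_le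
  have hexp : Real.exp A < Real.exp B := Real.exp_lt_exp.2 (hA.trans hB)
  obtain ⟨ε, hε0, hε⟩ : ∃ ε : ℝ, 0 < ε ∧
      (1 - Real.exp (A - ε)) / (Real.exp B - Real.exp (A - ε)) <
        (1 - Real.exp A) / (Real.exp B - Real.exp A) + η / 2 := by
    have hcont : ContinuousAt (fun ε : ℝ =>
        (1 - Real.exp (A - ε)) / (Real.exp B - Real.exp (A - ε))) 0 := by
      refine ContinuousAt.div (by fun_prop) (by fun_prop) ?_
      rw [sub_zero]; exact (sub_pos.2 hexp).ne'
    have h := hcont.eventually_lt (continuousAt_const (y :=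
      (1 - Real.exp A) / (Real.exp B - Real.exp A) + η / 2)) (by simpa using hη)
    obtain ⟨ε, h1, h2⟩ := ((h.filter_mono nhdsWithin_le_nhds).and
      (self_mem_nhdsWithin (s := Set.Ioi (0 : ℝ)))).exists
    exact ⟨ε, h2, h1⟩
  set D := Real.exp B - Real.exp (A - ε) with hD
  have hD0 : 0 < D := sub_pos.2 (Real.exp_lt_exp.2 (by linarith))
  -- The linear part of the potential then contributes exactly `η / 2` at the starting point 0; the
  -- other `η / 2` was spent on `ε`.
  set lam := η / 2 / (ε - A) with hlam
  have hlam0 : 0 < lam := div_pos (by linarith) (by linarith)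
  -- This is the drift condition of `measure_le_stoppedWalk_le` divided by `c ^ 2`.
  have hev1 : ∀ᶠ c in nhds (0 : ℝ), Real.exp A * (K * c ^ 2 / ε ^ 4) / D +
      lam * (K * c ^ 2 / ε ^ 3) < lam * (1 / 2) := by
    have hcont : ContinuousAt (fun c : ℝ => Real.exp A * (K * c ^ 2 / ε ^ 4) / D +
      lam * (K * c ^ 2 / ε ^ 3)) 0 := by fun_prop
    exact hcont.eventually_lt continuousAt_const (by simpa using hlam0)
  -- For the expected time the margin is `η / 2`. The last factor is the fraction of the drift `c ^
  -- 2 / 2` that survives the correction.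
  have hev2 : ∀ᶠ c in nhds (0 : ℝ), η / 2 - A < (η - A) * (1 - 2 * (K * c ^ 2 / (η / 2) ^ 3)) := by
    have hcont : ContinuousAt (fun c : ℝ => (η - A) * (1 - 2 * (K * c ^ 2 / (η / 2) ^ 3))) 0 := by
      fun_prop
    exact continuousAt_const.eventually_lt hcont (by simpa using hη)
  obtain ⟨r, hr0, hr⟩ := Metric.eventually_nhds_iff.1 (hev1.and hev2)
  refine ⟨min 1 (r / 2), by positivity, fun c hc0 hc => ?_⟩
  obtain ⟨h1, h2⟩ := hr (y := c) (by
    rw [Real.dist_0_eq_abs]; linarith [hc.trans (min_le_right _ _)])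
  have hc1 : |c| ≤ 1 := hc.trans (min_le_left _ _)
  have hc2 : 0 < c ^ 2 := by positivity
  constructor
  · intro T
    refine (measure_le_stoppedWalk_le hε0 hc1 (hK c hc1) (hA.trans hB) hlam0.le ?_ T).trans
      (ENNReal.ofReal_le_ofReal ?_)
    · have := mul_le_mul_of_nonneg_right h1.le hc2.le
      calc _ = (Real.exp A * (K * c ^ 2 / ε ^ 4) / D + lam * (K * c ^ 2 / ε ^ 3)) * c ^ 2 := by
            ring
        _ ≤ _ := this
        _ = _ := by ring
    · rw [crossingPotential, max_eq_left, max_eq_left (by linarith), Real.exp_zero]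
      · have : lam * (0 - A + ε) = η / 2 := by
          rw [hlam, show 0 - A + ε = ε - A by ring]
          exact div_mul_cancel₀ _ (by linarith)
        linarith
      · exact sub_nonneg.2 (Real.exp_le_exp.2 (by linarith))
  · set θ := 1 - 2 * (K * c ^ 2 / (η / 2) ^ 3) with hθ
    have hθ0 : 0 < θ := by
      by_contra hneg
      have := mul_nonpos_of_nonneg_of_nonpos (show 0 ≤ η - A by linarith) (not_lt.1 hneg)
      linarith
    have hκ : c ^ 2 / 2 - K * c ^ 4 / (η / 2) ^ 3 = c ^ 2 / 2 * θ := by rw [hθ]; ring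
    have key := lintegral_tsum_stoppedWalk_le (B := B) (half_pos hη) hc1 (hK c hc1) hA
      (by rw [hκ]; positivity)
    rw [hκ, mul_comm (c ^ 2 / 2) θ, ENNReal.ofReal_mul hθ0.le, mul_assoc] at key
    have h3 : ENNReal.ofReal (η / 2 - A) ≤ ENNReal.ofReal θ * ENNReal.ofReal (η - A) := by
      rw [← ENNReal.ofReal_mul hθ0.le]
      exact ENNReal.ofReal_le_ofReal (by rw [mul_comm]; exact h2.le)
    exact (ENNReal.mul_le_mul_iff_right (ENNReal.ofReal_pos.2 hθ0).ne'
      ENNReal.ofReal_ne_top).1 (key.trans h3)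

/-! ### Error probabilities and sample size of the sequential test -/

/-- The law of the noise variables of one test. -/
noncomputable abbrev noiseLaw : Measure (ℕ → ℝ) :=
  Measure.infinitePi fun _ : ℕ => gaussianReal 0 1

/-- One-sided form of the bounds for a test with target error probabilities `α` and `β`. -/
theorem exists_stoppedWalk_boundary_bounds {α β η : ℝ} (hα : 0 < α) (hβ : 0 < β) (hαβ : α + β < 1)
    (hη : 0 < η) :
    ∃ c₀ : ℝ, 0 < c₀ ∧ ∀ c : ℝ, c ≠ 0 → |c| ≤ c₀ →
      noiseLaw {ω | ∃ k, upperBoundary α β ≤ stoppedWalk (lowerBoundary α β) (upperBoundary α β)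
        (fun j => llrIncrement c (ω j)) k} ≤ ENNReal.ofReal (α + η) ∧
      ENNReal.ofReal (c ^ 2 / 2) * ∫⁻ ω, (exitTime (lowerBoundary α β) (upperBoundary α β)
        fun k => ∑ j ∈ Finset.range k, llrIncrement c (ω j) : ℕ∞) ∂noiseLaw ≤
          ENNReal.ofReal (Real.log (1 / β)) := by
  have hA : lowerBoundary α β < 0 := by
    refine Real.log_neg (div_pos hβ (by linarith)) ?_
    rw [div_lt_one (by linarith)]; linarith
  have hB : 0 < upperBoundary α β := by
    refine Real.log_pos ?_
    rw [one_lt_div hα]; linarith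
  have hA' : Real.exp (lowerBoundary α β) = β / (1 - α) :=
    Real.exp_log (div_pos hβ (by linarith))
  have hB' : Real.exp (upperBoundary α β) = (1 - β) / α :=
    Real.exp_log (div_pos (by linarith) hα)
  -- Since `-lowerBoundary α β = log (1 / β) + log (1 - α)`, an excess of at most `-log (1 - α)` is
  -- absorbed, so the bound on the expected time carries no error term.
  have hη' : 0 < min η (-Real.log (1 - α)) :=
    lt_min hη (neg_pos.2 (Real.log_neg (by linarith) (by linarith)))
  obtain ⟨c₀, hc₀, h⟩ := exists_stoppedWalk_bounds hA hB hη'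
  refine ⟨c₀, hc₀, fun c hc hcc => ?_⟩
  obtain ⟨h1, h2⟩ := h c hc hcc
  constructor
  · have hU : {ω : ℕ → ℝ | ∃ k, upperBoundary α β ≤ stoppedWalk (lowerBoundary α β)
        (upperBoundary α β) (fun j => llrIncrement c (ω j)) k} =
        ⋃ k, {ω | upperBoundary α β ≤ stoppedWalk (lowerBoundary α β) (upperBoundary α β)
          (fun j => llrIncrement c (ω j)) k} := by
      ext ω; simp
    rw [hU, Monotone.measure_iUnion]
    · refine iSup_le fun T => (h1 T).trans (ENNReal.ofReal_le_ofReal ?_)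
      -- Wald's boundaries are chosen so that the ideal crossing probability is exactly `α`.
      have h3 : (1 - β / (1 - α)) / ((1 - β) / α - β / (1 - α)) = α := by
        have e1 : 1 - α ≠ 0 := by linarith
        have e2 : 1 - α - β ≠ 0 := by linarith
        have e3 : (1 - β) / α - β / (1 - α) = (1 - α - β) / (α * (1 - α)) := by
          field_simp; ring
        rw [e3]
        field_simp
      rw [hA', hB', h3]
      linarith [min_le_left η (-Real.log (1 - α))]
    · refine monotone_nat_of_le_succ fun k ω hω => ?_
      have hω' : upperBoundary α β ≤ stoppedWalk (lowerBoundary α β) (upperBoundary α β)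
        (fun j => llrIncrement c (ω j)) k := hω
      change upperBoundary α β ≤ _
      rwa [stoppedWalk_eq_of_le (fun h => absurd h.2 hω'.not_gt) k.le_succ]
  · simp_rw [coe_exitTime_eq_tsum]
    refine h2.trans (ENNReal.ofReal_le_ofReal ?_)
    have h3 : lowerBoundary α β = -Real.log (1 / β) - Real.log (1 - α) := by
      rw [lowerBoundary, Real.log_div hβ.ne' (by linarith), one_div, Real.log_inv]; ring
    rw [h3]
    linarith [min_le_right η (-Real.log (1 - α))]

/-! ### Reduction of the sequential test to the stopped walk -/

theorem lowerBoundary_swap (α β : ℝ) : lowerBoundary β α = -upperBoundary α β := by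
  rw [lowerBoundary, upperBoundary, ← Real.log_inv, inv_div]

theorem upperBoundary_swap (α β : ℝ) : upperBoundary β α = -lowerBoundary α β := by
  rw [lowerBoundary, upperBoundary, ← Real.log_inv, inv_div]

theorem log_gaussianPDFReal_div {μ Γ : ℝ} (hΓ : 0 < Γ) (y : ℝ) :
    Real.log (gaussianPDFReal μ (Real.toNNReal Γ⁻¹) y / gaussianPDFReal 0 (Real.toNNReal Γ⁻¹) y) =
      Γ * (μ * y - μ ^ 2 / 2) := by
  have h0 : (√(2 * Real.pi * Γ⁻¹))⁻¹ ≠ 0 := by positivity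
  simp only [gaussianPDFReal, Real.coe_toNNReal _ (inv_pos.2 hΓ).le]
  rw [mul_div_mul_left _ _ h0, ← Real.exp_sub, Real.log_exp]
  field_simp
  ring

theorem logLikelihoodRatio_zero {μ Γ : ℝ} (hΓ : 0 < Γ) (w : ℕ → ℝ) :
    logLikelihoodRatio μ Γ (fun k => 0 + w k / √Γ) =
      fun k => ∑ j ∈ Finset.range k, llrIncrement (√Γ * μ) (w j) := by
  have h := Real.sq_sqrt hΓ.le
  have h0 : √Γ ≠ 0 := by positivity
  funext k
  refine Finset.sum_congr rfl fun j _ => ?_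
  rw [log_gaussianPDFReal_div hΓ, llrIncrement, mul_pow, h]
  have : Γ * (w j / √Γ) = √Γ * w j := by
    nth_rw 1 [← h]
    field_simp
  linear_combination μ * this

/-- Under the alternative the negated log-likelihood ratio is again a null walk, for `-c`. With the
swapped boundaries, the bounds for a zero entry also serve for a nonzero one. -/
theorem logLikelihoodRatio_signal {μ Γ : ℝ} (hΓ : 0 < Γ) (w : ℕ → ℝ) :
    logLikelihoodRatio μ Γ (fun k => μ + w k / √Γ) =
      fun k => -∑ j ∈ Finset.range k, llrIncrement (-(√Γ * μ)) (w j) := by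
  have h := Real.sq_sqrt hΓ.le
  have h0 : √Γ ≠ 0 := by positivity
  funext k
  rw [← Finset.sum_neg_distrib]
  refine Finset.sum_congr rfl fun j _ => ?_
  rw [log_gaussianPDFReal_div hΓ, llrIncrement, neg_sq, mul_pow, h]
  have : Γ * (w j / √Γ) = √Γ * w j := by
    nth_rw 1 [← h]
    field_simp
  linear_combination μ * this

theorem measurable_stoppedWalk (A B : ℝ) {f : ℝ → ℝ} (hf : Measurable f) (k : ℕ) :
    Measurable fun ω : ℕ → ℝ => stoppedWalk A B (fun j => f (ω j)) k :=
  measurable_of_recursion (g := fun z w => frozenStep A B z (f w)) (h₀ := 0)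
    (F := fun ω k => stoppedWalk A B (fun j => f (ω j)) k)
    (by simp only [Function.uncurry_def]; fun_prop) (fun _ => rfl) (fun _ _ => rfl) k

theorem measurable_coe_exitTime (A B : ℝ) {f : ℝ → ℝ} (hf : Measurable f) :
    Measurable fun ω : ℕ → ℝ =>
      ((exitTime A B fun k => ∑ j ∈ Finset.range k, f (ω j) : ℕ∞) : ENNReal) := by
  simp_rw [coe_exitTime_eq_tsum A B]
  exact Measurable.tsum fun k =>
    (measurable_one.indicator measurableSet_Ioo).comp (measurable_stoppedWalk A B hf k)

theorem measurable_slrtTime (μ Γ α β x : ℝ) :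
    Measurable fun w : ℕ → ℝ => (slrtTime μ Γ α β (fun k => x + w k / √Γ) : ENNReal) :=
  measurable_coe_exitTime (lowerBoundary α β) (upperBoundary α β) (f := fun w => Real.log
    (gaussianPDFReal μ (Real.toNNReal Γ⁻¹) (x + w / √Γ) /
      gaussianPDFReal 0 (Real.toNNReal Γ⁻¹) (x + w / √Γ))) (by fun_prop)

theorem slrtDecision_eq_true_iff {μ Γ α β : ℝ} (hB : 0 < upperBoundary α β) (y : ℕ → ℝ) :
    slrtDecision μ Γ α β y = true ↔ ∃ k, upperBoundary α β ≤
      stoppedWalk (lowerBoundary α β) (upperBoundary α β) (fun j => Real.log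
        (gaussianPDFReal μ (Real.toNNReal Γ⁻¹) (y j) /
          gaussianPDFReal 0 (Real.toNNReal Γ⁻¹) (y j))) k := by
  rw [exists_stoppedWalk_iff hB, slrtDecision, decide_eq_true_iff]
  rfl

theorem measurable_slrtDecision {μ Γ α β : ℝ} (hB : 0 < upperBoundary α β) (x : ℝ) :
    Measurable fun w : ℕ → ℝ => slrtDecision μ Γ α β (fun k => x + w k / √Γ) := by
  refine measurable_to_bool ?_
  have : (fun w : ℕ → ℝ => slrtDecision μ Γ α β (fun k => x + w k / √Γ)) ⁻¹' {true} =
      ⋃ k, {w | upperBoundary α β ≤ stoppedWalk (lowerBoundary α β) (upperBoundary α β)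
        (fun j => Real.log (gaussianPDFReal μ (Real.toNNReal Γ⁻¹) (x + w j / √Γ) /
          gaussianPDFReal 0 (Real.toNNReal Γ⁻¹) (x + w j / √Γ))) k} := by
    ext w
    simp only [Set.mem_preimage, Set.mem_singleton_iff, Set.mem_iUnion, Set.mem_ofPred_eq,
      slrtDecision_eq_true_iff hB]
  rw [this]
  exact MeasurableSet.iUnion fun k => measurableSet_le measurable_const
    (measurable_stoppedWalk _ _ (f := fun w => Real.log
    (gaussianPDFReal μ (Real.toNNReal Γ⁻¹) (x + w / √Γ) /
      gaussianPDFReal 0 (Real.toNNReal Γ⁻¹) (x + w / √Γ))) (by fun_prop) k)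

/-- For small precision, the sequential test nearly attains its target error probabilities, and
its expected total precision is at most `2 / μ ^ 2 * log (1 / β)` when the entry is zero and
`2 / μ ^ 2 * log (1 / α)` when it is not. -/
theorem exists_slrt_bounds {α β μ η : ℝ} (hα : 0 < α) (hβ : 0 < β) (hαβ : α + β < 1) (hμ : 0 < μ)
    (hη : 0 < η) :
    ∃ Γ₀ : ℝ, 0 < Γ₀ ∧ ∀ Γ : ℝ, 0 < Γ → Γ ≤ Γ₀ →
      noiseLaw {w | slrtDecision μ Γ α β (fun k => 0 + w k / √Γ) = true} ≤
        ENNReal.ofReal (α + η) ∧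
      noiseLaw {w | slrtDecision μ Γ α β (fun k => μ + w k / √Γ) = false} ≤
        ENNReal.ofReal (β + η) ∧
      ∫⁻ w, ENNReal.ofReal Γ * (slrtTime μ Γ α β (fun k => 0 + w k / √Γ) : ENNReal) ∂noiseLaw ≤
        ENNReal.ofReal (2 / μ ^ 2 * Real.log (1 / β)) ∧
      ∫⁻ w, ENNReal.ofReal Γ * (slrtTime μ Γ α β (fun k => μ + w k / √Γ) : ENNReal) ∂noiseLaw ≤
        ENNReal.ofReal (2 / μ ^ 2 * Real.log (1 / α)) := by
  obtain ⟨c₁, hc₁, h₁⟩ := exists_stoppedWalk_boundary_bounds hα hβ hαβ hη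
  obtain ⟨c₂, hc₂, h₂⟩ := exists_stoppedWalk_boundary_bounds hβ hα (by linarith) hη
  refine ⟨(min c₁ c₂ / μ) ^ 2, by positivity, fun Γ hΓ hΓ₀ => ?_⟩
  have hc : 0 < √Γ * μ := by positivity
  have hcle : √Γ * μ ≤ min c₁ c₂ := by
    rw [← le_div_iff₀ hμ]
    exact Real.sqrt_le_iff.2 ⟨by positivity, hΓ₀⟩
  obtain ⟨a1, a2⟩ := h₁ (√Γ * μ) hc.ne' (by
    rw [abs_of_pos hc]; exact hcle.trans (min_le_left _ _))
  obtain ⟨b1, b2⟩ := h₂ (-(√Γ * μ)) (neg_ne_zero.2 hc.ne') (by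
    rw [abs_neg, abs_of_pos hc]; exact hcle.trans (min_le_right _ _))
  rw [neg_sq] at b2
  -- Precision is `2 / μ ^ 2` times accumulated drift, which is what the walk bounds control.
  have hΓe : ENNReal.ofReal Γ = ENNReal.ofReal (2 / μ ^ 2) * ENNReal.ofReal ((√Γ * μ) ^ 2 / 2) := by
    rw [← ENNReal.ofReal_mul (by positivity), mul_pow, Real.sq_sqrt hΓ.le]
    congr 1
    field_simp
  have hB : 0 < upperBoundary α β := by
    refine Real.log_pos ?_
    rw [one_lt_div hα]; linarith
  have t0 (w : ℕ → ℝ) : slrtTime μ Γ α β (fun k => 0 + w k / √Γ) =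
      exitTime (lowerBoundary α β) (upperBoundary α β)
        fun k => ∑ j ∈ Finset.range k, llrIncrement (√Γ * μ) (w j) := by
    rw [← logLikelihoodRatio_zero hΓ]; rfl
  have t1 (w : ℕ → ℝ) : slrtTime μ Γ α β (fun k => μ + w k / √Γ) =
      exitTime (lowerBoundary β α) (upperBoundary β α)
        fun k => ∑ j ∈ Finset.range k, llrIncrement (-(√Γ * μ)) (w j) := by
    rw [← exitTime_neg, ← lowerBoundary_swap, ← upperBoundary_swap, ← logLikelihoodRatio_signal hΓ]; rfl
  refine ⟨?_, ?_, ?_, ?_⟩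
  · refine le_trans (measure_mono fun w hw => ?_) a1
    rw [Set.mem_ofPred_eq, exists_stoppedWalk_iff hB, ← t0, 
      ← congrFun (logLikelihoodRatio_zero hΓ w)]
    exact of_decide_eq_true hw
  -- A test that never stops also returns `false`. The finite expected time makes this a null event,
  -- so up to it a `false` result is a genuine exit below, that is, above for the negated walk.
  · have hfin : ∀ᵐ w ∂noiseLaw, (exitTime (lowerBoundary β α) (upperBoundary β α)
        (fun k => ∑ j ∈ Finset.range k, llrIncrement (-(√Γ * μ)) (w j)) : ENNReal) < ⊤ := by
      refine ae_lt_top (measurable_coe_exitTime _ _ (by fun_prop)) fun htop => ?_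
      rw [htop, ENNReal.mul_top (ENNReal.ofReal_pos.2 (by positivity)).ne'] at b2
      exact ENNReal.ofReal_ne_top (top_le_iff.1 b2)
    refine le_trans (measure_mono_ae ?_) b1
    filter_upwards [hfin] with w hw hdec
    have hdec' : slrtDecision μ Γ α β (fun k => μ + w k / √Γ) = false := hdec
    rcases exitTime_eq_top_or (lowerBoundary β α) (upperBoundary β α)
      fun k => ∑ j ∈ Finset.range k, llrIncrement (-(√Γ * μ)) (w j) with ⟨h, -⟩ | ⟨τ, h, hτ, -⟩
    · simp [h] at hw
    · refine exists_le_stoppedWalk h ?_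
      have h3 := of_decide_eq_false hdec'
      rw [t1, h, ENat.toNat_natCast, logLikelihoodRatio_signal hΓ, not_le] at h3
      simp only [lowerBoundary_swap, Set.mem_Ioo, not_and, not_lt] at hτ
      exact hτ (by linarith)
  · simp_rw [t0]
    rw [lintegral_const_mul' _ _ ENNReal.ofReal_ne_top, hΓe, mul_assoc,
      ENNReal.ofReal_mul (by positivity)]
    gcongr
  · simp_rw [t1]
    rw [lintegral_const_mul' _ _ ENNReal.ofReal_ne_top, hΓe, mul_assoc,
      ENNReal.ofReal_mul (by positivity)]
    gcongr

variable {n₁ n₂ s : ℕ} {δ μ Γ : ℝ}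
  {rule : History n₁ n₂ → Finset (Entry n₁ n₂) → Finset (Entry n₁ n₂)}
  {S : Finset (Entry n₁ n₂)}

/-! ### The procedure as a Markov chain -/

instance : MeasurableSpace (History n₁ n₂) := ⊤

instance : DiscreteMeasurableSpace (History n₁ n₂) := ⟨fun _ => trivial⟩

/-- The result of the test of `q` that follows the history `h`, for noise `w`. -/
noncomputable def testResult (s : ℕ) (δ μ Γ : ℝ) (S : Finset (Entry n₁ n₂)) (h : History n₁ n₂)
    (q : Entry n₁ n₂) (w : ℕ → ℝ) : Bool :=
  slrtDecision μ Γ (typeI n₁ n₂ δ) (typeII s δ h) (observations μ Γ S q w)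

/-- The number of measurements of the test of `q` that follows the history `h`. -/
noncomputable def testTime (s : ℕ) (δ μ Γ : ℝ) (S : Finset (Entry n₁ n₂)) (h : History n₁ n₂)
    (q : Entry n₁ n₂) (w : ℕ → ℝ) : ENNReal :=
  slrtTime μ Γ (typeI n₁ n₂ δ) (typeII s δ h) (observations μ Γ S q w)

theorem candidates_nonempty {h : History n₁ n₂} (H : ¬Finished s δ rule h) :
    (candidates s δ rule h).Nonempty :=
  Finset.nonempty_iff_ne_empty.2 fun e => H (Or.inr e)

open Classical in
/-- One step of the procedure. -/
noncomputable def nextHistory (s : ℕ) (δ μ Γ : ℝ)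
    (rule : History n₁ n₂ → Finset (Entry n₁ n₂) → Finset (Entry n₁ n₂))
    (S : Finset (Entry n₁ n₂)) (h : History n₁ n₂) (x : Step n₁ n₂) : History n₁ n₂ :=
  if H : Finished s δ rule h then h
  else h ++ [(x.1 ⟨candidates s δ rule h, candidates_nonempty H⟩,
    testResult s δ μ Γ S h (x.1 ⟨candidates s δ rule h, candidates_nonempty H⟩) x.2)]

open Classical in
/-- The precision used in one step of the procedure. -/
noncomputable def stepPrecision (s : ℕ) (δ μ Γ : ℝ)
    (rule : History n₁ n₂ → Finset (Entry n₁ n₂) → Finset (Entry n₁ n₂))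
    (S : Finset (Entry n₁ n₂)) (h : History n₁ n₂) (x : Step n₁ n₂) : ENNReal :=
  if H : Finished s δ rule h then 0
  else ENNReal.ofReal Γ * testTime s δ μ Γ S h
    (x.1 ⟨candidates s δ rule h, candidates_nonempty H⟩) x.2

theorem history_succ (ω : ℕ → Step n₁ n₂) (t : ℕ) :
    history s δ μ Γ rule S ω (t + 1) =
      nextHistory s δ μ Γ rule S (history s δ μ Γ rule S ω t) (ω t) := rfl

theorem ofReal_mul_measurementCount (ω : ℕ → Step n₁ n₂) (t : ℕ) :
    ENNReal.ofReal Γ * (measurementCount s δ μ Γ rule S ω t : ENNReal) =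
      stepPrecision s δ μ Γ rule S (history s δ μ Γ rule S ω t) (ω t) := by
  simp only [measurementCount, stepPrecision]
  split_ifs
  · simp
  · rfl

theorem measurable_testTime (h : History n₁ n₂) (q : Entry n₁ n₂) :
    Measurable (testTime s δ μ Γ S h q) :=
  measurable_slrtTime _ _ _ _ _

/-- The upper boundary of every test is positive. -/
def PositiveBoundaries (n₁ n₂ s : ℕ) (δ : ℝ) : Prop :=
  ∀ h : History n₁ n₂, 0 < upperBoundary (typeI n₁ n₂ δ) (typeII s δ h)

theorem measurable_testResult (hB : PositiveBoundaries n₁ n₂ s δ) (h : History n₁ n₂)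
    (q : Entry n₁ n₂) : Measurable (testResult s δ μ Γ S h q) :=
  measurable_slrtDecision (hB h) _

theorem measurable_apply_draw {β : Type*} [MeasurableSpace β]
    (R : {R : Finset (Entry n₁ n₂) // R.Nonempty}) {F : Entry n₁ n₂ → (ℕ → ℝ) → β}
    (hF : ∀ q, Measurable (F q)) : Measurable fun x : Step n₁ n₂ => F (x.1 R) x.2 := by
  have h1 : Measurable (Function.uncurry F) := measurable_from_prod_countable_right hF
  have h2 : Measurable fun x : Step n₁ n₂ => x.1 R := (measurable_pi_apply _).comp measurable_fst
  exact h1.comp (h2.prodMk measurable_snd)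

theorem measurable_nextHistory (hB : PositiveBoundaries n₁ n₂ s δ) :
    Measurable (Function.uncurry (nextHistory s δ μ Γ rule S)) := by
  refine measurable_from_prod_countable_right fun h => ?_
  simp only [Function.uncurry_apply_pair, nextHistory]
  split_ifs with H
  · exact measurable_const
  · refine measurable_apply_draw ⟨candidates s δ rule h, candidates_nonempty H⟩
      (F := fun q w => h ++ [(q, testResult s δ μ Γ S h q w)]) fun q => ?_
    have h3 : Measurable fun b : Bool => h ++ [(q, b)] := measurable_of_countable _
    exact h3.comp (measurable_testResult hB h q)

theorem measurable_stepPrecision :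
    Measurable (Function.uncurry (stepPrecision s δ μ Γ rule S)) := by
  refine measurable_from_prod_countable_right fun h => ?_
  simp only [Function.uncurry_apply_pair, stepPrecision]
  split_ifs with H
  · exact measurable_const
  · exact (measurable_apply_draw ⟨candidates s δ rule h, candidates_nonempty H⟩
      (F := testTime s δ μ Γ S h) (measurable_testTime h)).const_mul _

theorem lintegral_stepLaw (R : {R : Finset (Entry n₁ n₂) // R.Nonempty})
    {F : Entry n₁ n₂ → (ℕ → ℝ) → ENNReal} (hF : ∀ q, Measurable (F q)) :
    ∫⁻ x, F (x.1 R) x.2 ∂stepLaw n₁ n₂ =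
      ∑ q ∈ R.1, (R.1.card : ENNReal)⁻¹ * ∫⁻ w, F q w ∂noiseLaw := by
  have hR : Measurable fun ξ : {R : Finset (Entry n₁ n₂) // R.Nonempty} → Entry n₁ n₂ => ξ R :=
    measurable_pi_apply R
  rw [stepLaw, lintegral_prod _ (measurable_apply_draw R hF).aemeasurable]
  have hmp := measurePreserving_eval (fun R : {R : Finset (Entry n₁ n₂) // R.Nonempty} =>
    (PMF.uniformOfFinset R.1 R.2).toMeasure) R
  calc _ = ∫⁻ q, ∫⁻ w, F q w ∂noiseLaw ∂(PMF.uniformOfFinset R.1 R.2).toMeasure := by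
        rw [← hmp.map_eq, lintegral_map (measurable_of_countable _) hR]
    _ = _ := by
        rw [lintegral_fintype, ← Finset.sum_subset (Finset.subset_univ R.1)]
        · refine Finset.sum_congr rfl fun q hq => ?_
          rw [PMF.toMeasure_apply_singleton _ _ (measurableSet_singleton q),
            PMF.uniformOfFinset_apply_of_mem _ hq, mul_comm]
        · intro q _ hq
          rw [PMF.toMeasure_apply_singleton _ _ (measurableSet_singleton q),
            PMF.uniformOfFinset_apply_of_notMem _ hq, mul_zero]

/-- An average over a uniform draw is at most `b` if the bounds for the single draws are on
average. -/
theorem lintegral_stepLaw_le (R : {R : Finset (Entry n₁ n₂) // R.Nonempty})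
    {F : Entry n₁ n₂ → (ℕ → ℝ) → ENNReal} (hF : ∀ q, Measurable (F q)) {B : Entry n₁ n₂ → ℝ}
    {b : ℝ} (hB : ∀ q ∈ R.1, 0 ≤ B q)
    (hFB : ∀ q ∈ R.1, ∫⁻ w, F q w ∂noiseLaw ≤ ENNReal.ofReal (B q))
    (hb : ∑ q ∈ R.1, B q ≤ R.1.card * b) :
    ∫⁻ x, F (x.1 R) x.2 ∂stepLaw n₁ n₂ ≤ ENNReal.ofReal b := by
  have hc : (0 : ℝ) < R.1.card := by exact_mod_cast R.2.card_pos
  rw [lintegral_stepLaw R hF, ← Finset.mul_sum]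
  calc _ ≤ (R.1.card : ENNReal)⁻¹ * ∑ q ∈ R.1, ENNReal.ofReal (B q) := by
        gcongr with q hq
        exact hFB q hq
    _ = ENNReal.ofReal ((R.1.card : ℝ)⁻¹ * ∑ q ∈ R.1, B q) := by
        rw [ENNReal.ofReal_mul (by positivity), ENNReal.ofReal_inv_of_pos hc,
          ENNReal.ofReal_natCast, ENNReal.ofReal_sum_of_nonneg hB]
    _ ≤ _ := by
        refine ENNReal.ofReal_le_ofReal ?_
        rwa [inv_mul_le_iff₀ hc]

/-- Expectation of a function of a test result that is wrong with probability at most `e`. -/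
theorem lintegral_result_le {r : (ℕ → ℝ) → Bool} (hr : Measurable r) {b : Bool} {ψ : Bool → ℝ}
    {M D e : ℝ} (hM : 0 ≤ M) (hD : 0 ≤ D) (he : 0 ≤ e) (hb : ψ b ≤ M) (hnb : ψ (!b) ≤ M + D)
    (hre : noiseLaw {w | r w ≠ b} ≤ ENNReal.ofReal e) :
    ∫⁻ w, ENNReal.ofReal (ψ (r w)) ∂noiseLaw ≤ ENNReal.ofReal (M + D * e) := by
  have hs : MeasurableSet {w | r w ≠ b} := hr (measurableSet_singleton b).compl
  calc ∫⁻ w, ENNReal.ofReal (ψ (r w)) ∂noiseLaw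
      ≤ ∫⁻ w, (ENNReal.ofReal M + ENNReal.ofReal D * {w | r w ≠ b}.indicator 1 w) ∂noiseLaw := by
        refine lintegral_mono fun w => ?_
        by_cases h : r w = b
        · simp only [h]
          exact (ENNReal.ofReal_le_ofReal hb).trans le_self_add
        · have h' : r w = !b := by cases hw : r w <;> cases hb' : b <;> simp_all
          rw [Set.indicator_of_mem (show w ∈ {w | r w ≠ b} from h), Pi.one_apply, mul_one,
            ← ENNReal.ofReal_add hM hD, h']
          exact ENNReal.ofReal_le_ofReal hnb
    _ = ENNReal.ofReal M + ENNReal.ofReal D * noiseLaw {w | r w ≠ b} := by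
        rw [lintegral_add_left measurable_const, lintegral_const, measure_univ, mul_one,
          lintegral_const_mul _ (measurable_one.indicator hs), lintegral_indicator_one hs]
    _ ≤ ENNReal.ofReal M + ENNReal.ofReal D * ENNReal.ofReal e := by gcongr
    _ = _ := by rw [← ENNReal.ofReal_mul hD, ← ENNReal.ofReal_add hM (by positivity)]

/-! ### Histories -/

theorem unqueried_append (h : History n₁ n₂) (q : Entry n₁ n₂) (b : Bool) :
    unqueried (h ++ [(q, b)]) = (unqueried h).erase q := by
  ext i
  simp [unqueried, not_or, and_comm]

theorem pivot_append_of_eq_some {h : History n₁ n₂} {p : Entry n₁ n₂} (hp : pivot h = some p)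
    (x : Entry n₁ n₂ × Bool) : pivot (h ++ [x]) = some p := by
  simp only [pivot, Option.map_eq_some_iff] at hp ⊢
  obtain ⟨a, ha, rfl⟩ := hp
  exact ⟨a, by simp [List.find?_append, ha], rfl⟩

theorem find?_eq_none_of_pivot {h : History n₁ n₂} (hp : pivot h = none) :
    (h.find? fun p => p.2) = none := by
  simpa [pivot] using hp

theorem pivot_append_true {h : History n₁ n₂} (hp : pivot h = none) (q : Entry n₁ n₂) :
    pivot (h ++ [(q, true)]) = some q := by
  simp [pivot, List.find?_append, find?_eq_none_of_pivot hp]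

theorem pivot_append_false {h : History n₁ n₂} (hp : pivot h = none) (q : Entry n₁ n₂) :
    pivot (h ++ [(q, false)]) = none := by
  simp [pivot, List.find?_append, find?_eq_none_of_pivot hp]

theorem snd_eq_false_of_pivot {h : History n₁ n₂} (hp : pivot h = none)
    {x : Entry n₁ n₂ × Bool} (hx : x ∈ h) : x.2 = false := by
  have := List.find?_eq_none.1 (find?_eq_none_of_pivot hp) x hx
  simpa using this

theorem mem_of_pivot {h : History n₁ n₂} {p : Entry n₁ n₂} (hp : pivot h = some p) :
    (p, true) ∈ h := by
  simp only [pivot, Option.map_eq_some_iff] at hp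
  obtain ⟨⟨a, b⟩, ha, rfl⟩ := hp
  have h1 := List.find?_some ha
  have h2 := List.mem_of_find?_eq_some ha
  simp only at h1
  rwa [h1] at h2

theorem consistent_append (h : History n₁ n₂) (q : Entry n₁ n₂) (b : Bool)
    (S' : Finset (Entry n₁ n₂)) :
    Consistent (h ++ [(q, b)]) S' ↔ Consistent h S' ∧ b = decide (q ∈ S') := by
  simp [Consistent, or_imp, forall_and]

theorem candidates_of_pivot_none {h : History n₁ n₂} (hp : pivot h = none) :
    candidates s δ rule h = if h.length < searchLength n₁ n₂ s δ then unqueried h else ∅ := by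
  simp only [candidates, hp]

theorem candidates_of_pivot_some {h : History n₁ n₂} {p : Entry n₁ n₂} (hp : pivot h = some p) :
    candidates s δ rule h =
      if (unqueried h ∩ cross p).Nonempty then rule h (unqueried h ∩ cross p) else ∅ := by
  simp only [candidates, hp]

theorem candidates_subset_unqueried (hrule : IsExplorationRule rule) (h : History n₁ n₂) :
    candidates s δ rule h ⊆ unqueried h := by
  cases hp : pivot h with
  | none => rw [candidates_of_pivot_none hp]; split_ifs <;> simp
  | some p =>
    rw [candidates_of_pivot_some hp]
    split_ifs with hne
    · exact (hrule h _ hne).2.trans Finset.inter_subset_left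
    · simp

/-- A submatrix is determined by a row and a column that meet in it. -/
theorem mem_iff_of_mem_submatrices (hS : S ∈ submatrices n₁ n₂ s) {p : Entry n₁ n₂} (hp : p ∈ S)
    (i : Entry n₁ n₂) : i ∈ S ↔ (i.1, p.2) ∈ S ∧ (p.1, i.2) ∈ S := by
  obtain ⟨S₁, S₂, -, rfl⟩ := hS
  simp only [Finset.mem_product] at hp ⊢
  tauto

theorem card_of_mem_submatrices (hS : S ∈ submatrices n₁ n₂ s) : S.card = s := by
  obtain ⟨S₁, S₂, h, rfl⟩ := hS
  rw [Finset.card_product, h]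

theorem estimator_eq_of_determined (hS : S ∈ submatrices n₁ n₂ s) {h : History n₁ n₂}
    (hc : Consistent h S) (hd : Determined s h) : estimator s h = S := by
  have H : ∃! S', S' ∈ submatrices n₁ n₂ s ∧ Consistent h S' :=
    ⟨S, ⟨hS, hc⟩, fun S' hS' => hd hS' ⟨hS, hc⟩⟩
  rw [estimator, dif_pos H]
  exact hd H.choose_spec.1 ⟨hS, hc⟩

theorem mem_of_notMem_unqueried {h : History n₁ n₂} {i : Entry n₁ n₂} (hi : i ∉ unqueried h) :
    ∃ b, (i, b) ∈ h := by
  have h1 : i ∈ h.map Prod.fst := by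
    by_contra hn
    exact hi (by simpa [unqueried] using hn)
  obtain ⟨⟨j, b⟩, hj, rfl⟩ := List.mem_map.1 h1
  exact ⟨b, hj⟩

/-- Once the row and the column of a correctly declared entry are explored without error, the
support is determined. -/
theorem determined_of_unqueried_inter_cross {h : History n₁ n₂} {p : Entry n₁ n₂}
    (hp : pivot h = some p) (he : unqueried h ∩ cross p = ∅) : Determined s h := by
  rintro A ⟨hA, hAc⟩ B ⟨hB, hBc⟩
  have hmem {C : Finset (Entry n₁ n₂)} (hC : Consistent h C) : p ∈ C := by
    simpa using hC _ (mem_of_pivot hp)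
  have hiff (i : Entry n₁ n₂) (hi : i ∈ cross p) : i ∈ A ↔ i ∈ B := by
    obtain ⟨b, hb⟩ := mem_of_notMem_unqueried (h := h) (i := i) fun hu => by
      have : i ∈ unqueried h ∩ cross p := Finset.mem_inter.2 ⟨hu, hi⟩
      simp [he] at this
    have h1 := hAc _ hb
    rw [hBc _ hb] at h1
    exact (decide_eq_decide.1 h1).symm
  ext i
  rw [mem_iff_of_mem_submatrices hA (hmem hAc), mem_iff_of_mem_submatrices hB (hmem hBc),
    hiff (i.1, p.2) (by simp [cross]), hiff (p.1, i.2) (by simp [cross])]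

theorem subset_unqueried {h : History n₁ n₂} (hp : pivot h = none) (hc : Consistent h S) :
    S ⊆ unqueried h := by
  intro i hi
  by_contra hu
  obtain ⟨b, hb⟩ := mem_of_notMem_unqueried hu
  have h1 := hc _ hb
  rw [snd_eq_false_of_pivot hp hb] at h1
  simp [hi] at h1

/-! ### Termination -/

theorem history_eq_of_finished {ω : ℕ → Step n₁ n₂} {t T : ℕ} (htT : t ≤ T)
    (h : Finished s δ rule (history s δ μ Γ rule S ω t)) :
    history s δ μ Γ rule S ω T = history s δ μ Γ rule S ω t := by
  induction T, htT using Nat.le_induction with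
  | base => rfl
  | succ T _ ih => rw [history_succ, ih, nextHistory, dif_pos h]

theorem estimate_eq_of_finished {ω : ℕ → Step n₁ n₂} {T : ℕ}
    (h : Finished s δ rule (history s δ μ Γ rule S ω T)) :
    estimate s δ μ Γ rule S ω = estimator s (history s δ μ Γ rule S ω T) := by
  have hτ : Finished s δ rule (history s δ μ Γ rule S ω (stoppingTime s δ μ Γ rule S ω)) :=
    Nat.sInf_mem (s := {t | Finished s δ rule (history s δ μ Γ rule S ω t)}) ⟨T, h⟩
  have hle : stoppingTime s δ μ Γ rule S ω ≤ T := Nat.sInf_le h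
  rw [estimate, history_eq_of_finished hle hτ]

theorem finished_of_unqueried_eq_empty {h : History n₁ n₂} (hu : unqueried h = ∅) :
    Finished s δ rule h := by
  right
  cases hp : pivot h with
  | none => rw [candidates_of_pivot_none hp, hu, ite_self]
  | some p => rw [candidates_of_pivot_some hp, hu]; simp

/-- Each draw comes from the unqueried entries, so no entry repeats. Hence the procedure is over
after `n₁ * n₂` steps, a deterministic horizon at which the potentials can be evaluated. -/
theorem finished_or_nodup (hrule : IsExplorationRule rule) {ω : ℕ → Step n₁ n₂}
    (hω : ∀ t R, (ω t).1 R ∈ R.1) (t : ℕ) :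
    Finished s δ rule (history s δ μ Γ rule S ω t) ∨
      ((history s δ μ Γ rule S ω t).length = t ∧
        ((history s δ μ Γ rule S ω t).map Prod.fst).Nodup) := by
  induction t with
  | zero => right; simp [history]
  | succ t ih =>
    by_cases H : Finished s δ rule (history s δ μ Γ rule S ω t)
    · left; rwa [history_eq_of_finished t.le_succ H]
    · obtain ⟨hl, hn⟩ := ih.resolve_left H
      right
      rw [history_succ, nextHistory, dif_neg H]
      refine ⟨by simp [hl], ?_⟩
      have h1 := candidates_subset_unqueried hrule _ (hω t ⟨_, candidates_nonempty H⟩)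
      simp only [unqueried, Finset.mem_sdiff, Finset.mem_univ, true_and, List.mem_toFinset] at h1
      rw [List.map_append, List.nodup_append]
      refine ⟨hn, by simp, fun a ha b hb => ?_⟩
      rw [List.map_singleton, List.mem_singleton] at hb
      rintro rfl
      rw [hb] at ha
      exact h1 ha

theorem finished_history (hrule : IsExplorationRule rule) {ω : ℕ → Step n₁ n₂}
    (hω : ∀ t R, (ω t).1 R ∈ R.1) :
    Finished s δ rule (history s δ μ Γ rule S ω (n₁ * n₂)) := by
  rcases finished_or_nodup hrule hω (n₁ * n₂) with h | ⟨hl, hn⟩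
  · exact h
  · refine finished_of_unqueried_eq_empty ?_
    rw [unqueried, Finset.sdiff_eq_empty_iff_subset, Finset.univ_subset_iff,
      ← Finset.card_eq_iff_eq_univ, List.toFinset_card_of_nodup hn, List.length_map, hl]
    simp

theorem ae_law_mem : ∀ᵐ ω ∂law n₁ n₂, ∀ t R, (ω t).1 R ∈ R.1 := by
  refine ae_all_iff.2 fun t => ae_all_iff.2 fun R => ?_
  have h1 : ∀ᵐ q ∂(PMF.uniformOfFinset R.1 R.2).toMeasure, q ∈ R.1 := by
    rw [ae_iff, PMF.toMeasure_apply_eq_zero_iff _ (Set.toFinite _).measurableSet,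
      PMF.support_uniformOfFinset]
    exact Set.disjoint_left.2 fun q hq hq' => hq' hq
  have h2 := (measurePreserving_eval (fun R : {R : Finset (Entry n₁ n₂) // R.Nonempty} =>
    (PMF.uniformOfFinset R.1 R.2).toMeasure) R).quasiMeasurePreserving.ae h1
  have h3 : ∀ᵐ x ∂stepLaw n₁ n₂, x.1 R ∈ R.1 := by
    rw [stepLaw]
    exact Measure.quasiMeasurePreserving_fst.ae h2
  exact (measurePreserving_eval_infinitePi (fun _ : ℕ => stepLaw n₁ n₂)
    t).quasiMeasurePreserving.ae h3

/-! ### Counting entries inside and outside the support -/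

/-- The number of elements of `U` inside `S`. -/
def ones (S U : Finset (Entry n₁ n₂)) : ℕ := (U.filter (· ∈ S)).card

/-- The number of elements of `U` outside `S`. -/
def zeros (S U : Finset (Entry n₁ n₂)) : ℕ := (U.filter (· ∉ S)).card

theorem ones_add_zeros (S U : Finset (Entry n₁ n₂)) : ones S U + zeros S U = U.card :=
  Finset.card_filter_add_card_filter_not _

theorem ones_mono (S : Finset (Entry n₁ n₂)) {U V : Finset (Entry n₁ n₂)} (h : U ⊆ V) :
    ones S U ≤ ones S V := Finset.card_le_card (Finset.filter_subset_filter _ h)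

theorem zeros_mono (S : Finset (Entry n₁ n₂)) {U V : Finset (Entry n₁ n₂)} (h : U ⊆ V) :
    zeros S U ≤ zeros S V := Finset.card_le_card (Finset.filter_subset_filter _ h)

theorem ones_erase_of_notMem {U : Finset (Entry n₁ n₂)} {q : Entry n₁ n₂} (hq : q ∉ S) :
    ones S (U.erase q) = ones S U := by
  rw [ones, ones, Finset.filter_erase, Finset.erase_eq_of_notMem (by simp [hq])]

theorem zeros_erase_of_mem {U : Finset (Entry n₁ n₂)} {q : Entry n₁ n₂} (hq : q ∈ S) :
    zeros S (U.erase q) = zeros S U := by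
  rw [zeros, zeros, Finset.filter_erase, Finset.erase_eq_of_notMem (by simp [hq])]

theorem ones_erase_add_one {U : Finset (Entry n₁ n₂)} {q : Entry n₁ n₂} (hU : q ∈ U) (hq : q ∈ S) :
    ones S (U.erase q) + 1 = ones S U := by
  rw [ones, ones, Finset.filter_erase, Finset.card_erase_add_one (by simp [hU, hq])]

theorem zeros_erase_add_one {U : Finset (Entry n₁ n₂)} {q : Entry n₁ n₂} (hU : q ∈ U)
    (hq : q ∉ S) : zeros S (U.erase q) + 1 = zeros S U := by
  rw [zeros, zeros, Finset.filter_erase, Finset.card_erase_add_one (by simp [hU, hq])]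

theorem ones_eq_card {U : Finset (Entry n₁ n₂)} (h : S ⊆ U) : ones S U = S.card := by
  rw [ones, Finset.filter_mem_eq_inter, Finset.inter_eq_right.2 h]

theorem sum_ite_mem_eq (S U : Finset (Entry n₁ n₂)) (x y : ℝ) :
    ∑ q ∈ U, (if q ∈ S then x else y) = ones S U * x + zeros S U * y := by
  rw [Finset.sum_ite, Finset.sum_const, Finset.sum_const, nsmul_eq_mul, nsmul_eq_mul]; rfl

theorem card_unqueried_le (h : History n₁ n₂) : (unqueried h).card ≤ n₁ * n₂ :=
  (Finset.card_le_univ _).trans (by simp)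

theorem card_cross_le (p : Entry n₁ n₂) : (cross p).card ≤ n₁ + n₂ := by
  have : cross p ⊆ (Finset.univ.image fun j => (p.1, j)) ∪ Finset.univ.image fun i => (i, p.2) := by
    rintro ⟨i, j⟩ hi
    simp only [cross, Finset.mem_filter, Finset.mem_univ, true_and] at hi
    rcases hi with rfl | rfl <;> simp
  refine (Finset.card_le_card this).trans ((Finset.card_union_le _ _).trans ?_)
  rw [add_comm]
  gcongr <;> exact Finset.card_image_le.trans (by simp)

/-! ### Potentials for the procedure -/

/-- Bounds for the error probabilities and the expected precisions of all tests. -/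
structure TestBounds (n₁ n₂ s : ℕ) (δ μ Γ : ℝ) (S : Finset (Entry n₁ n₂))
    (a b₁ b₂ c₀ c₁ c₂ : ℝ) : Prop where
  boundaries : PositiveBoundaries n₁ n₂ s δ
  a_nonneg : 0 ≤ a
  b₁_nonneg : 0 ≤ b₁
  b₂_nonneg : 0 ≤ b₂
  c₀_nonneg : 0 ≤ c₀
  c₁_nonneg : 0 ≤ c₁
  c₂_nonneg : 0 ≤ c₂
  error_zero : ∀ (h : History n₁ n₂), ∀ q ∉ S,
    noiseLaw {w | testResult s δ μ Γ S h q w ≠ decide (q ∈ S)} ≤ ENNReal.ofReal a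
  error_search : ∀ (h : History n₁ n₂), pivot h = none → ∀ q ∈ S,
    noiseLaw {w | testResult s δ μ Γ S h q w ≠ decide (q ∈ S)} ≤ ENNReal.ofReal b₁
  error_refine : ∀ (h : History n₁ n₂) (p : Entry n₁ n₂), pivot h = some p → ∀ q ∈ S,
    noiseLaw {w | testResult s δ μ Γ S h q w ≠ decide (q ∈ S)} ≤ ENNReal.ofReal b₂
  precision_search : ∀ (h : History n₁ n₂), pivot h = none → ∀ q ∉ S,
    ∫⁻ w, ENNReal.ofReal Γ * testTime s δ μ Γ S h q w ∂noiseLaw ≤ ENNReal.ofReal c₀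
  precision_refine : ∀ (h : History n₁ n₂) (p : Entry n₁ n₂), pivot h = some p → ∀ q ∉ S,
    ∫⁻ w, ENNReal.ofReal Γ * testTime s δ μ Γ S h q w ∂noiseLaw ≤ ENNReal.ofReal c₁
  precision_one : ∀ (h : History n₁ n₂), ∀ q ∈ S,
    ∫⁻ w, ENNReal.ofReal Γ * testTime s δ μ Γ S h q w ∂noiseLaw ≤ ENNReal.ofReal c₂

open Classical in
/-- Bound for the conditional probability of a wrong estimate, given the history. -/
noncomputable def errorPotential (s : ℕ) (δ a b₁ b₂ : ℝ) (S : Finset (Entry n₁ n₂))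
    (h : History n₁ n₂) : ℝ :=
  if Consistent h S then
    match pivot h with
    | none => (1 - s / (n₁ * n₂ : ℕ) : ℝ) ^ (searchLength n₁ n₂ s δ - h.length) +
        a * zeros S (unqueried h) + b₁ + b₂ * (s - 1)
    | some p => a * zeros S (unqueried h ∩ cross p) + b₂ * ones S (unqueried h ∩ cross p)
  else 1

/-- Bound for the conditional expectation of the precision that is still to be used, given the
history. -/
noncomputable def precisionPotential (b₁ c₀ c₁ c₂ : ℝ) (S : Finset (Entry n₁ n₂))
    (h : History n₁ n₂) : ℝ :=
  c₂ * ones S (unqueried h) +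
    match pivot h with
    | none => c₀ * (1 - b₁)⁻¹ * (zeros S (unqueried h) / (ones S (unqueried h) + 1)) +
        c₁ * (n₁ + n₂)
    | some p => c₁ * zeros S (unqueried h ∩ cross p)

section

variable {a b₁ b₂ c₀ c₁ c₂ : ℝ}

theorem errorPotential_of_not_consistent {h : History n₁ n₂} (hc : ¬Consistent h S) :
    errorPotential s δ a b₁ b₂ S h = 1 := by
  rw [errorPotential, if_neg hc]

theorem errorPotential_of_pivot_none {h : History n₁ n₂} (hc : Consistent h S)
    (hp : pivot h = none) : errorPotential s δ a b₁ b₂ S h =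
      (1 - s / (n₁ * n₂ : ℕ) : ℝ) ^ (searchLength n₁ n₂ s δ - h.length) +
        a * zeros S (unqueried h) + b₁ + b₂ * (s - 1) := by
  rw [errorPotential, if_pos hc]; simp only [hp]

theorem errorPotential_of_pivot_some {h : History n₁ n₂} {p : Entry n₁ n₂} (hc : Consistent h S)
    (hp : pivot h = some p) : errorPotential s δ a b₁ b₂ S h =
      a * zeros S (unqueried h ∩ cross p) + b₂ * ones S (unqueried h ∩ cross p) := by
  rw [errorPotential, if_pos hc]; simp only [hp]

theorem precisionPotential_of_pivot_none {h : History n₁ n₂} (hp : pivot h = none) :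
    precisionPotential b₁ c₀ c₁ c₂ S h = c₂ * ones S (unqueried h) +
      (c₀ * (1 - b₁)⁻¹ * (zeros S (unqueried h) / (ones S (unqueried h) + 1)) +
        c₁ * (n₁ + n₂)) := by
  rw [precisionPotential]; simp only [hp]

theorem precisionPotential_of_pivot_some {h : History n₁ n₂} {p : Entry n₁ n₂}
    (hp : pivot h = some p) : precisionPotential b₁ c₀ c₁ c₂ S h =
      c₂ * ones S (unqueried h) + c₁ * zeros S (unqueried h ∩ cross p) := by
  rw [precisionPotential]; simp only [hp]

/-! ### Error probability of the procedure -/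

theorem le_mul_of_mem_submatrices (hS : S ∈ submatrices n₁ n₂ s) : s ≤ n₁ * n₂ := by
  rw [← card_of_mem_submatrices hS]
  exact (Finset.card_le_univ S).trans (by simp)

theorem one_sub_div_nonneg (hs : 1 ≤ s) (hS : S ∈ submatrices n₁ n₂ s) :
    0 ≤ (1 - s / (n₁ * n₂ : ℕ) : ℝ) := by
  have h := le_mul_of_mem_submatrices hS
  have h1 : (0 : ℝ) < (n₁ * n₂ : ℕ) := by exact_mod_cast (by omega : 0 < n₁ * n₂)
  rw [sub_nonneg, div_le_one h1]
  exact_mod_cast h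

/-- Each test removes its own term from the union bound and raises the potential to 1 with at most
the probability removed. In the search, `b₁` is charged only if a one is drawn, which happens at
most once in an error-free search. -/
theorem lintegral_errorPotential_step (hs : 1 ≤ s) (hS : S ∈ submatrices n₁ n₂ s)
    (hrule : IsExplorationRule rule) (hT : TestBounds n₁ n₂ s δ μ Γ S a b₁ b₂ c₀ c₁ c₂)
    (h : History n₁ n₂) :
    ∫⁻ x, ENNReal.ofReal (errorPotential s δ a b₁ b₂ S (nextHistory s δ μ Γ rule S h x))
      ∂stepLaw n₁ n₂ ≤ ENNReal.ofReal (errorPotential s δ a b₁ b₂ S h) := by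
  by_cases H : Finished s δ rule h
  · simp [nextHistory, H]
  set ψ : Entry n₁ n₂ → Bool → ℝ := fun q b => errorPotential s δ a b₁ b₂ S (h ++ [(q, b)]) with hψ
  simp only [nextHistory, H, dite_false]
  have hm (q : Entry n₁ n₂) :
      Measurable fun w => ENNReal.ofReal (ψ q (testResult s δ μ Γ S h q w)) :=
    (measurable_of_countable fun b => ENNReal.ofReal (ψ q b)).comp
      (measurable_testResult hT.boundaries h q)
  have hs1 : (0 : ℝ) ≤ s - 1 := by
    rw [sub_nonneg]; exact_mod_cast hs
  have ha := hT.a_nonneg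
  have hb₁ := hT.b₁_nonneg
  have hb₂ := hT.b₂_nonneg
  have hρ := one_sub_div_nonneg hs hS
  by_cases hc : Consistent h S
  swap
  · refine lintegral_stepLaw_le ⟨candidates s δ rule h, candidates_nonempty H⟩ hm (B := fun _ => 1)
      (fun _ _ => zero_le_one) (fun q _ => ?_) ?_
    · have : ∀ b, ψ q b = 1 := fun b => errorPotential_of_not_consistent
        fun h' => hc ((consistent_append _ _ _ _).1 h').1
      simp [this]
    · rw [errorPotential_of_not_consistent hc]; simp
  have hwrong (q : Entry n₁ n₂) : ψ q (!decide (q ∈ S)) = 1 :=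
    errorPotential_of_not_consistent fun h' => by
      have := ((consistent_append _ _ _ _).1 h').2
      simp at this
  have hright (q : Entry n₁ n₂) : Consistent (h ++ [(q, decide (q ∈ S))]) S :=
    (consistent_append _ _ _ _).2 ⟨hc, rfl⟩
  cases hp : pivot h with
  | none =>
    have hcand := candidates_of_pivot_none (s := s) (δ := δ) (rule := rule) hp
    have hne := candidates_nonempty H
    have hlen : h.length < searchLength n₁ n₂ s δ := by
      by_contra hl
      rw [hcand, if_neg hl] at hne
      simp at hne
    rw [if_pos hlen] at hcand
    obtain ⟨j, hj⟩ : ∃ j, searchLength n₁ n₂ s δ - h.length = j + 1 :=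
      ⟨searchLength n₁ n₂ s δ - h.length - 1, by omega⟩
    have hj' : searchLength n₁ n₂ s δ - (h.length + 1) = j := by omega
    set ρ : ℝ := 1 - s / (n₁ * n₂ : ℕ) with hρd
    -- All results so far are negative and correct, so no element of `S` has been queried.
    have hones : ones S (unqueried h) = s := by
      rw [ones_eq_card (subset_unqueried hp hc), card_of_mem_submatrices hS]
    refine lintegral_stepLaw_le ⟨candidates s δ rule h, candidates_nonempty H⟩ hm
      -- Each branch is a bound on the potential after the correct result plus 1 (its value after a
      -- wrong one) times the error probability.
      (B := fun q => if q ∈ S then a * zeros S (unqueried h) + b₂ * (s - 1) + 1 * b₁ else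
        ρ ^ j + a * (zeros S (unqueried h) - 1) + b₁ + b₂ * (s - 1) + 1 * a) (fun q hq => ?_)
      (fun q hq => ?_) ?_
    · simp only [hcand] at hq
      split_ifs with hqS
      · positivity
      · have h1 : (1 : ℝ) ≤ zeros S (unqueried h) := by
          exact_mod_cast (zeros_erase_add_one hq hqS).symm ▸ Nat.le_add_left 1 _
        have h2 : 0 ≤ a * (zeros S (unqueried h) - 1) := mul_nonneg ha (by linarith)
        positivity
    · simp only [hcand] at hq
      split_ifs with hqS
      · refine lintegral_result_le (measurable_testResult hT.boundaries h q)
          (b := decide (q ∈ S)) (ψ := ψ q) (by positivity) zero_le_one hb₁ ?_ ?_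
          (hT.error_search h hp q hqS)
        · have hp' : pivot (h ++ [(q, decide (q ∈ S))]) = some q := by
            rw [decide_eq_true hqS]; exact pivot_append_true hp q
          rw [hψ]
          beta_reduce
          rw [errorPotential_of_pivot_some (hright q) hp', unqueried_append]
          have h1 : zeros S ((unqueried h).erase q ∩ cross q) ≤ zeros S (unqueried h) :=
            zeros_mono S (Finset.inter_subset_left.trans (Finset.erase_subset _ _))
          have h2 : ones S ((unqueried h).erase q ∩ cross q) + 1 ≤ s := by
            rw [← hones, ← ones_erase_add_one hq hqS]
            gcongr
            exact ones_mono S Finset.inter_subset_left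
          have h1' : (zeros S ((unqueried h).erase q ∩ cross q) : ℝ) ≤ zeros S (unqueried h) := by
            exact_mod_cast h1
          have h2' : (ones S ((unqueried h).erase q ∩ cross q) : ℝ) ≤ s - 1 := by
            rw [le_sub_iff_add_le]; exact_mod_cast h2
          gcongr
        · rw [hwrong]
          have : 0 ≤ a * zeros S (unqueried h) + b₂ * (s - 1) := by positivity
          linarith
      · have hz := zeros_erase_add_one hq hqS
        have hz' : (zeros S ((unqueried h).erase q) : ℝ) = zeros S (unqueried h) - 1 := by
          rw [← hz]; push_cast; ring
        have hM : 0 ≤ ρ ^ j + a * (zeros S (unqueried h) - 1) + b₁ + b₂ * (s - 1) := by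
          rw [← hz']; positivity
        refine lintegral_result_le (measurable_testResult hT.boundaries h q)
          (b := decide (q ∈ S)) (ψ := ψ q) hM zero_le_one ha ?_ ?_ (hT.error_zero h q hqS)
        · have hp' : pivot (h ++ [(q, decide (q ∈ S))]) = none := by
            rw [decide_eq_false hqS]; exact pivot_append_false hp q
          rw [hψ]
          beta_reduce
          rw [errorPotential_of_pivot_none (hright q) hp', unqueried_append, List.length_append,
            List.length_singleton, hj', hz']
        · rw [hwrong]; linarith
    · rw [errorPotential_of_pivot_none hc hp, sum_ite_mem_eq]
      simp only [hcand]
      rw [← ones_add_zeros S, hones, hj]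
      set u := zeros S (unqueried h) with hu
      have hn := card_unqueried_le h
      rw [← ones_add_zeros S, hones] at hn
      have hnR : (s + u : ℝ) ≤ (n₁ * n₂ : ℕ) := by exact_mod_cast hn
      have hn0 : (0 : ℝ) < (n₁ * n₂ : ℕ) := by
        have : (1 : ℝ) ≤ s := by exact_mod_cast hs
        have : (0 : ℝ) ≤ u := by positivity
        linarith
      -- Since at most `n₁ * n₂` entries remain and all `s` ones are among them, a draw misses `S`
      -- with probability at most `1 - s / (n₁ * n₂)`.
      have key : (u : ℝ) ≤ (s + u) * ρ := by
        rw [hρd, mul_sub, mul_one]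
        have : (s + u : ℝ) * (s / (n₁ * n₂ : ℕ)) ≤ s := by
          rw [← mul_div_assoc, div_le_iff₀ hn0, mul_comm]
          gcongr
        linarith
      have key2 : u * ρ ^ j ≤ (s + u) * ρ ^ (j + 1) := by
        rw [pow_succ, mul_comm (ρ ^ j), ← mul_assoc]
        gcongr
      rw [← hρd, Nat.cast_add]
      linarith
  | some p =>
    have hcand := candidates_of_pivot_some (s := s) (δ := δ) (rule := rule) hp
    have hne := candidates_nonempty H
    have hUne : (unqueried h ∩ cross p).Nonempty := by
      by_contra hU
      rw [hcand, if_neg hU] at hne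
      simp at hne
    rw [if_pos hUne] at hcand
    have hsub : candidates s δ rule h ⊆ unqueried h ∩ cross p := by
      rw [hcand]; exact (hrule h _ hUne).2
    set U := unqueried h ∩ cross p with hU
    refine lintegral_stepLaw_le ⟨candidates s δ rule h, candidates_nonempty H⟩ hm
      (B := fun q => a * zeros S U + b₂ * ones S U) (fun q hq => by positivity)
      (fun q hq => ?_) ?_
    · have hqU : q ∈ U := hsub hq
      have hval : ψ q (decide (q ∈ S)) = a * zeros S (U.erase q) + b₂ * ones S (U.erase q) := by
        rw [hψ]
        beta_reduce
        rw [errorPotential_of_pivot_some (hright q) (pivot_append_of_eq_some hp _),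
          unqueried_append, Finset.erase_inter]
      by_cases hqS : q ∈ S
      · have hz : (ones S (U.erase q) : ℝ) = ones S U - 1 := by
          rw [← ones_erase_add_one hqU hqS]; push_cast; ring
        have hM : 0 ≤ a * zeros S U + b₂ * (ones S U - 1) := by rw [← hz]; positivity
        refine (lintegral_result_le (measurable_testResult hT.boundaries h q)
          (b := decide (q ∈ S)) (ψ := ψ q) hM zero_le_one hb₂ ?_ ?_
          (hT.error_refine h p hp q hqS)).trans (le_of_eq ?_)
        · rw [hval, hz, zeros_erase_of_mem hqS]
        · rw [hwrong]; linarith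
        · congr 1; ring
      · have hz : (zeros S (U.erase q) : ℝ) = zeros S U - 1 := by
          rw [← zeros_erase_add_one hqU hqS]; push_cast; ring
        have hM : 0 ≤ a * (zeros S U - 1) + b₂ * ones S U := by rw [← hz]; positivity
        refine (lintegral_result_le (measurable_testResult hT.boundaries h q)
          (b := decide (q ∈ S)) (ψ := ψ q) hM zero_le_one ha ?_ ?_
          (hT.error_zero h q hqS)).trans (le_of_eq ?_)
        · rw [hval, hz, ones_erase_of_notMem hqS]
        · rw [hwrong]; linarith
        · congr 1; ring
    · rw [errorPotential_of_pivot_some hc hp, Finset.sum_const, nsmul_eq_mul]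

/-- With correct results the only way to fail is to exhaust the search length, where the power in
the potential has exponent 0. An exhausted cross would determine the support. -/
theorem one_le_errorPotential_of_estimator_ne (hs : 1 ≤ s) (hS : S ∈ submatrices n₁ n₂ s)
    (hrule : IsExplorationRule rule) (ha : 0 ≤ a) (hb₁ : 0 ≤ b₁) (hb₂ : 0 ≤ b₂)
    {h : History n₁ n₂} (hf : Finished s δ rule h) (hne : estimator s h ≠ S) :
    1 ≤ errorPotential s δ a b₁ b₂ S h := by
  by_cases hc : Consistent h S
  swap
  · rw [errorPotential_of_not_consistent hc]
  have hnd : ¬Determined s h := fun hd => hne (estimator_eq_of_determined hS hc hd)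
  have hcand : candidates s δ rule h = ∅ := hf.resolve_left fun h' => hnd h'.2
  cases hp : pivot h with
  | none =>
    have hlen : searchLength n₁ n₂ s δ ≤ h.length := by
      by_contra hl
      rw [candidates_of_pivot_none hp, if_pos (not_le.1 hl)] at hcand
      have hcard := card_of_mem_submatrices hS
      have hsub := subset_unqueried hp hc
      rw [hcand, Finset.subset_empty] at hsub
      rw [hsub, Finset.card_empty] at hcard
      omega
    rw [errorPotential_of_pivot_none hc hp, Nat.sub_eq_zero_of_le hlen, pow_zero]
    have hs1 : (0 : ℝ) ≤ s - 1 := by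
      rw [sub_nonneg]; exact_mod_cast hs
    have : 0 ≤ a * zeros S (unqueried h) := by positivity
    have : 0 ≤ b₂ * (s - 1) := by positivity
    linarith
  | some p =>
    refine absurd (determined_of_unqueried_inter_cross hp ?_) hnd
    by_contra hU
    have hU' := Finset.nonempty_iff_ne_empty.2 hU
    rw [candidates_of_pivot_some hp, if_pos hU'] at hcand
    exact (hrule h _ hU').1.ne_empty hcand

/-- Markov's inequality for the potential at time `n₁ * n₂`, when the procedure has almost surely
finished. -/
theorem law_estimate_ne_le (hs : 1 ≤ s) (hS : S ∈ submatrices n₁ n₂ s)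
    (hrule : IsExplorationRule rule) (hT : TestBounds n₁ n₂ s δ μ Γ S a b₁ b₂ c₀ c₁ c₂) :
    law n₁ n₂ {ω | estimate s δ μ Γ rule S ω ≠ S} ≤
      ENNReal.ofReal (errorPotential s δ a b₁ b₂ S []) := by
  have hm := measurable_nextHistory (μ := μ) (Γ := Γ) (rule := rule) (S := S) hT.boundaries
  have hφ : Measurable fun h : History n₁ n₂ => ENNReal.ofReal (errorPotential s δ a b₁ b₂ S h) :=
    measurable_of_countable _
  have key := lintegral_le_of_potential (stepLaw n₁ n₂) (h₀ := [])
    (F := history s δ μ Γ rule S) hm (fun _ => rfl) history_succ hφ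
    (lintegral_errorPotential_step hs hS hrule hT) (n₁ * n₂)
  refine le_trans ?_ key
  have hH := measurable_of_recursion (h₀ := []) (F := history s δ μ Γ rule S) hm (fun _ => rfl)
    history_succ (n₁ * n₂)
  calc law n₁ n₂ {ω | estimate s δ μ Γ rule S ω ≠ S}
      ≤ law n₁ n₂ {ω | 1 ≤ ENNReal.ofReal
          (errorPotential s δ a b₁ b₂ S (history s δ μ Γ rule S ω (n₁ * n₂)))} := by
        refine measure_mono_ae ?_
        filter_upwards [ae_law_mem] with ω hω hne
        have hf := finished_history (s := s) (δ := δ) (μ := μ) (Γ := Γ) (S := S) hrule hω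
        have hne' : estimate s δ μ Γ rule S ω ≠ S := hne
        rw [estimate_eq_of_finished hf] at hne'
        exact ENNReal.one_le_ofReal.2 (one_le_errorPotential_of_estimator_ne hs hS hrule
          hT.a_nonneg hT.b₁_nonneg hT.b₂_nonneg hf hne')
    _ ≤ _ := by
        have := mul_meas_ge_le_lintegral (μ := law n₁ n₂) (hφ.comp hH) 1
        rwa [one_mul] at this

/-! ### Expected precision of the procedure -/

theorem precisionPotential_nonneg (hb₁ : b₁ < 1) (hc₀ : 0 ≤ c₀) (hc₁ : 0 ≤ c₁) (hc₂ : 0 ≤ c₂)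
    (h : History n₁ n₂) : 0 ≤ precisionPotential b₁ c₀ c₁ c₂ S h := by
  have : 0 < (1 - b₁)⁻¹ := inv_pos.2 (by linarith)
  cases hp : pivot h with
  | none => rw [precisionPotential_of_pivot_none hp]; positivity
  | some p => rw [precisionPotential_of_pivot_some hp]; positivity

/-- No correctness of earlier results is assumed: a false pivot still leads to at most one cross of
zeros, and every one is paid for wherever it is queried. -/
theorem lintegral_precision_add_potential_step (hrule : IsExplorationRule rule)
    (hT : TestBounds n₁ n₂ s δ μ Γ S a b₁ b₂ c₀ c₁ c₂) (hb : b₁ < 1) (h : History n₁ n₂) :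
    ∫⁻ x, (stepPrecision s δ μ Γ rule S h x + ENNReal.ofReal
      (precisionPotential b₁ c₀ c₁ c₂ S (nextHistory s δ μ Γ rule S h x))) ∂stepLaw n₁ n₂ ≤
      ENNReal.ofReal (precisionPotential b₁ c₀ c₁ c₂ S h) := by
  by_cases H : Finished s δ rule h
  · simp [nextHistory, stepPrecision, H]
  set ψ : Entry n₁ n₂ → Bool → ℝ :=
    fun q b => precisionPotential b₁ c₀ c₁ c₂ S (h ++ [(q, b)]) with hψ
  simp only [nextHistory, stepPrecision, H, dite_false]
  have hm1 (q : Entry n₁ n₂) : Measurable fun w =>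
      ENNReal.ofReal (ψ q (testResult s δ μ Γ S h q w)) :=
    (measurable_of_countable fun b => ENNReal.ofReal (ψ q b)).comp
      (measurable_testResult hT.boundaries h q)
  have hm2 (q : Entry n₁ n₂) : Measurable fun w => ENNReal.ofReal Γ * testTime s δ μ Γ S h q w :=
    (measurable_testTime h q).const_mul _
  have hc₀ := hT.c₀_nonneg
  have hc₁ := hT.c₁_nonneg
  have hc₂ := hT.c₂_nonneg
  have hb₁ := hT.b₁_nonneg
  set k := (1 - b₁)⁻¹ with hk
  have hk0 : 0 < k := inv_pos.2 (by linarith)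
  have hkb : k * (1 - b₁) = 1 := inv_mul_cancel₀ (by linarith)
  have hsplit {q : Entry n₁ n₂} {c M : ℝ} (hc : 0 ≤ c) (hM : 0 ≤ M)
      (h1 : ∫⁻ w, ENNReal.ofReal Γ * testTime s δ μ Γ S h q w ∂noiseLaw ≤ ENNReal.ofReal c)
      (h2 : ∫⁻ w, ENNReal.ofReal (ψ q (testResult s δ μ Γ S h q w)) ∂noiseLaw ≤
        ENNReal.ofReal M) :
      ∫⁻ w, (ENNReal.ofReal Γ * testTime s δ μ Γ S h q w +
        ENNReal.ofReal (ψ q (testResult s δ μ Γ S h q w))) ∂noiseLaw ≤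
        ENNReal.ofReal (c + M) := by
    rw [lintegral_add_left (hm2 q), ENNReal.ofReal_add hc hM]
    exact add_le_add h1 h2
  have hconst {q : Entry n₁ n₂} {M : ℝ} (hM : ∀ b, ψ q b ≤ M) :
      ∫⁻ w, ENNReal.ofReal (ψ q (testResult s δ μ Γ S h q w)) ∂noiseLaw ≤ ENNReal.ofReal M := by
    calc _ ≤ ∫⁻ _, ENNReal.ofReal M ∂noiseLaw :=
          lintegral_mono fun w => ENNReal.ofReal_le_ofReal (hM _)
      _ = _ := by simp
  cases hp : pivot h with
  | none =>
    have hcand := candidates_of_pivot_none (s := s) (δ := δ) (rule := rule) hp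
    have hne := candidates_nonempty H
    have hlen : h.length < searchLength n₁ n₂ s δ := by
      by_contra hl
      rw [hcand, if_neg hl] at hne
      simp at hne
    rw [if_pos hlen] at hcand
    set U := unqueried h with hU
    have htrue (q : Entry n₁ n₂) : ψ q true ≤ c₂ * ones S (U.erase q) + c₁ * (n₁ + n₂) := by
      rw [hψ]
      beta_reduce
      rw [precisionPotential_of_pivot_some (pivot_append_true hp q), unqueried_append]
      have h1 : zeros S (U.erase q ∩ cross q) ≤ n₁ + n₂ :=
        (Finset.card_le_card ((Finset.filter_subset _ _).trans Finset.inter_subset_right)).trans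
          (card_cross_le q)
      have h1' : (zeros S (U.erase q ∩ cross q) : ℝ) ≤ n₁ + n₂ := by exact_mod_cast h1
      gcongr
    have hfalse (q : Entry n₁ n₂) : ψ q false = c₂ * ones S (U.erase q) +
        (c₀ * k * (zeros S (U.erase q) / (ones S (U.erase q) + 1)) + c₁ * (n₁ + n₂)) := by
      rw [hψ]
      beta_reduce
      rw [precisionPotential_of_pivot_none (pivot_append_false hp q), unqueried_append]
    refine lintegral_stepLaw_le ⟨candidates s δ rule h, candidates_nonempty H⟩
      (F := fun q w => ENNReal.ofReal Γ * testTime s δ μ Γ S h q w +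
        ENNReal.ofReal (ψ q (testResult s δ μ Γ S h q w))) (fun q => (hm2 q).add (hm1 q))
      -- A one is found, which leaves at most one cross to pay for, or is missed with probability at
      -- most `b₁`; then the search goes on with one fewer, so that `v + 1` becomes `v` in the
      -- denominator. For a zero, the value after a `false` result bounds both outcomes.
      (B := fun q => if q ∈ S then
          c₂ + (c₂ * (ones S U - 1) + c₁ * (n₁ + n₂) + c₀ * k * (zeros S U / ones S U) * b₁)
        else c₀ + (c₂ * ones S U +
          (c₀ * k * ((zeros S U - 1) / (ones S U + 1)) + c₁ * (n₁ + n₂))))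
      (fun q hq => ?_) (fun q hq => ?_) ?_
    · simp only [hcand] at hq
      split_ifs with hqS
      · rw [← ones_erase_add_one hq hqS]
        push_cast
        rw [add_sub_cancel_right]
        positivity
      · rw [← zeros_erase_add_one hq hqS]
        push_cast
        rw [add_sub_cancel_right]
        positivity
    · simp only [hcand] at hq
      split_ifs with hqS
      · have hz : (ones S (U.erase q) : ℝ) = ones S U - 1 := by
          rw [← ones_erase_add_one hq hqS]; push_cast; ring
        have hM : 0 ≤ c₂ * (ones S U - 1 : ℝ) + c₁ * (n₁ + n₂) := by
          rw [← hz]; positivity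
        refine hsplit hc₂ (by positivity) (hT.precision_one h q hqS) ?_
        refine lintegral_result_le (measurable_testResult hT.boundaries h q)
          (b := decide (q ∈ S)) (ψ := ψ q) hM (by positivity) hb₁ ?_ ?_
          (hT.error_search h hp q hqS)
        · rw [decide_eq_true hqS, ← hz]
          exact htrue q
        · rw [decide_eq_true hqS, Bool.not_true, hfalse, hz, zeros_erase_of_mem hqS,
            sub_add_cancel]
          linarith
      · have hz : (zeros S (U.erase q) : ℝ) = zeros S U - 1 := by
          rw [← zeros_erase_add_one hq hqS]; push_cast; ring
        have hnn : 0 ≤ c₀ * k * (zeros S (U.erase q) / (ones S (U.erase q) + 1) : ℝ) := by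
          positivity
        have hf := hfalse q
        rw [hz, ones_erase_of_notMem hqS] at hf
        refine hsplit hc₀ ?_ (hT.precision_search h hp q hqS) (hconst fun b => ?_)
        · rw [← hz]; positivity
        · cases b
          · exact hf.le
          · have ht := htrue q
            rw [hz, ones_erase_of_notMem hqS] at hnn
            rw [ones_erase_of_notMem hqS] at ht
            linarith
    · rw [precisionPotential_of_pivot_none hp, sum_ite_mem_eq]
      simp only [hcand]
      rw [← ones_add_zeros S]
      set u : ℝ := ((zeros S U : ℕ) : ℝ) with hu
      set v : ℝ := ((ones S U : ℕ) : ℝ) with hv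
      have hu0 : 0 ≤ u := Nat.cast_nonneg _
      have hv0 : 0 ≤ v := Nat.cast_nonneg _
      -- Only an inequality, because `u / 0 = 0` when no one is left.
      have h1 : v * (u / v) ≤ u := by
        rcases hv0.eq_or_lt with h | h
        · rw [← h]; simpa using hu0
        · rw [mul_div_cancel₀ _ h.ne']
      have h2 : v * (c₀ * k * (u / v) * b₁) ≤ c₀ * k * b₁ * u := by
        calc _ = c₀ * k * b₁ * (v * (u / v)) := by ring
          _ ≤ _ := by gcongr
      -- The recursion of the mean number `u / (v + 1)` of zeros drawn before the first one. The
      -- surplus `c₀ * k * u` covers the missed ones and the current test, since `k = k * b₁ + 1`.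
      have h3 : (v + u) * (c₀ * k * (u / (v + 1))) =
          u * (c₀ * k * ((u - 1) / (v + 1))) + c₀ * k * u := by
        field_simp
        ring
      have h4 : c₀ * k * u = c₀ * k * b₁ * u + c₀ * u := by
        linear_combination (c₀ * u) * hkb
      rw [Nat.cast_add, ← hu, ← hv]
      calc _ = (v + u) * (c₂ * v + c₁ * (n₁ + n₂)) + v * (c₀ * k * (u / v) * b₁) +
            u * (c₀ * k * ((u - 1) / (v + 1))) + c₀ * u := by ring
        _ ≤ (v + u) * (c₂ * v + c₁ * (n₁ + n₂)) + (v + u) * (c₀ * k * (u / (v + 1))) := by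
            linarith
        _ = _ := by ring
  | some p =>
    have hcand := candidates_of_pivot_some (s := s) (δ := δ) (rule := rule) hp
    have hne := candidates_nonempty H
    have hUne : (unqueried h ∩ cross p).Nonempty := by
      by_contra hU
      rw [hcand, if_neg hU] at hne
      simp at hne
    rw [if_pos hUne] at hcand
    have hsub : candidates s δ rule h ⊆ unqueried h ∩ cross p := by
      rw [hcand]; exact (hrule h _ hUne).2
    refine lintegral_stepLaw_le ⟨candidates s δ rule h, candidates_nonempty H⟩
      (F := fun q w => ENNReal.ofReal Γ * testTime s δ μ Γ S h q w +
        ENNReal.ofReal (ψ q (testResult s δ μ Γ S h q w))) (fun q => (hm2 q).add (hm1 q))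
      (B := fun q => precisionPotential b₁ c₀ c₁ c₂ S h)
      (fun q hq => precisionPotential_nonneg hb hc₀ hc₁ hc₂ h) (fun q hq => ?_) ?_
    · have hqU : q ∈ unqueried h ∩ cross p := hsub hq
      have hqu : q ∈ unqueried h := Finset.mem_of_mem_inter_left hqU
      have hval (b : Bool) : ψ q b = c₂ * ones S ((unqueried h).erase q) +
          c₁ * zeros S ((unqueried h ∩ cross p).erase q) := by
        rw [hψ]
        beta_reduce
        rw [precisionPotential_of_pivot_some (pivot_append_of_eq_some hp _), unqueried_append,
          Finset.erase_inter]
      have hnn : 0 ≤ c₂ * ones S ((unqueried h).erase q) +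
          c₁ * zeros S ((unqueried h ∩ cross p).erase q) := by positivity
      rw [precisionPotential_of_pivot_some hp]
      by_cases hqS : q ∈ S
      · refine (hsplit hc₂ hnn (hT.precision_one h q hqS) (hconst fun b => (hval b).le)).trans
          (le_of_eq ?_)
        rw [zeros_erase_of_mem hqS, ← ones_erase_add_one hqu hqS]
        push_cast
        congr 1; ring
      · refine (hsplit hc₁ hnn (hT.precision_refine h p hp q hqS)
          (hconst fun b => (hval b).le)).trans (le_of_eq ?_)
        rw [ones_erase_of_notMem hqS, ← zeros_erase_add_one hqU hqS]
        push_cast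
        congr 1; ring
    · rw [Finset.sum_const, nsmul_eq_mul]

theorem lintegral_totalPrecision_le (hrule : IsExplorationRule rule)
    (hT : TestBounds n₁ n₂ s δ μ Γ S a b₁ b₂ c₀ c₁ c₂) (hb : b₁ < 1) :
    ∫⁻ ω, totalPrecision s δ μ Γ rule S ω ∂law n₁ n₂ ≤
      ENNReal.ofReal (precisionPotential b₁ c₀ c₁ c₂ S []) := by
  refine le_trans (lintegral_mono fun ω => ?_) (lintegral_tsum_le_of_potential (stepLaw n₁ n₂)
    (F := history s δ μ Γ rule S) (measurable_nextHistory hT.boundaries) (fun _ => rfl)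
    history_succ measurable_stepPrecision (measurable_of_countable _)
    (lintegral_precision_add_potential_step hrule hT hb))
  simp only [totalPrecision, ofReal_mul_measurementCount]
  exact ENNReal.sum_le_tsum _

end

/-! ### Choice of the parameters -/

theorem typeII_of_pivot_none {n₁ n₂ s : ℕ} {δ : ℝ} {h : History n₁ n₂} (hp : pivot h = none) :
    typeII s δ h = δ / 4 := by
  simp only [typeII, hp]

theorem typeII_of_pivot_some {n₁ n₂ s : ℕ} {δ : ℝ} {h : History n₁ n₂} {p : Entry n₁ n₂}
    (hp : pivot h = some p) : typeII s δ h = δ / (8 * s) := by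
  simp only [typeII, hp]

/-- Only two pairs of target error probabilities and two signal values occur, so one threshold for
`Γ` serves all histories, entries and supports. -/
theorem exists_testBounds {n₁ n₂ s : ℕ} {δ μ η : ℝ} (hs : 1 ≤ s) (hsn : s ≤ n₁ * n₂)
    (hδ₀ : 0 < δ) (hδ₁ : δ ≤ 1) (hμ : 0 < μ) (hη : 0 < η) :
    ∃ Γ₀ : ℝ, 0 < Γ₀ ∧ ∀ Γ : ℝ, 0 < Γ → Γ ≤ Γ₀ → ∀ S : Finset (Entry n₁ n₂),
      TestBounds n₁ n₂ s δ μ Γ S (δ / (8 * (n₁ * n₂ : ℕ)) + η) (δ / 4 + η) (δ / (8 * s) + η)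
        (2 / μ ^ 2 * Real.log (4 / δ)) (2 / μ ^ 2 * Real.log (8 * s / δ))
        (2 / μ ^ 2 * Real.log (8 * (n₁ * n₂ : ℕ) / δ)) := by
  have hs' : (1 : ℝ) ≤ s := by exact_mod_cast hs
  have hn' : (1 : ℝ) ≤ (n₁ * n₂ : ℕ) := by exact_mod_cast hs.trans hsn
  have small {x : ℝ} (hx : 1 ≤ x) : δ / (8 * x) ≤ 1 / 8 := by
    rw [div_le_div_iff₀ (by positivity) (by norm_num)]; linarith
  have hα : 0 < δ / (8 * (n₁ * n₂ : ℕ)) := by positivity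
  have hβ : 0 < δ / (8 * s) := by positivity
  have log_nonneg {x : ℝ} (hx : 1 ≤ x) : 0 ≤ 2 / μ ^ 2 * Real.log (8 * x / δ) :=
    mul_nonneg (by positivity) (Real.log_nonneg (by rw [one_le_div hδ₀]; linarith))
  obtain ⟨Γ₁, hΓ₁, h₁⟩ := exists_slrt_bounds hα (show 0 < δ / 4 by positivity)
    (by linarith [small hn']) hμ hη
  obtain ⟨Γ₂, hΓ₂, h₂⟩ := exists_slrt_bounds hα hβ (by linarith [small hn', small hs']) hμ hη
  refine ⟨min Γ₁ Γ₂, lt_min hΓ₁ hΓ₂, fun Γ hΓ hle S => ?_⟩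
  obtain ⟨p1, p2, p3, p4⟩ := h₁ Γ hΓ (hle.trans (min_le_left _ _))
  obtain ⟨q1, q2, q3, q4⟩ := h₂ Γ hΓ (hle.trans (min_le_right _ _))
  rw [one_div_div] at p3 p4 q3 q4
  have s0 {q : Entry n₁ n₂} (hq : q ∉ S) (w : ℕ → ℝ) :
      observations μ Γ S q w = fun k => 0 + w k / √Γ := by
    funext k; simp [observations, signal, hq]
  have s1 {q : Entry n₁ n₂} (hq : q ∈ S) (w : ℕ → ℝ) :
      observations μ Γ S q w = fun k => μ + w k / √Γ := by
    funext k; simp [observations, signal, hq]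
  constructor
  · intro h
    refine Real.log_pos ?_
    rw [typeI, one_lt_div hα]
    cases hp : pivot h with
    | none => rw [typeII_of_pivot_none hp]; linarith [small hn']
    | some p => rw [typeII_of_pivot_some hp]; linarith [small hn', small hs']
  · positivity
  · positivity
  · positivity
  · exact mul_nonneg (by positivity) (Real.log_nonneg (by rw [one_le_div hδ₀]; linarith))
  · exact log_nonneg hs'
  · exact log_nonneg hn'
  · intro h q hq
    simp only [testResult, s0 hq, decide_eq_false hq, ne_eq, Bool.not_eq_false]
    cases hp : pivot h with
    | none => rw [typeII_of_pivot_none hp]; exact p1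
    | some p => rw [typeII_of_pivot_some hp]; exact q1
  · intro h hp q hq
    simp only [testResult, s1 hq, decide_eq_true hq, ne_eq, Bool.not_eq_true]
    rw [typeII_of_pivot_none hp]; exact p2
  · intro h p hp q hq
    simp only [testResult, s1 hq, decide_eq_true hq, ne_eq, Bool.not_eq_true]
    rw [typeII_of_pivot_some hp]; exact q2
  · intro h hp q hq
    simp only [testTime, s0 hq, typeII_of_pivot_none hp]
    exact p3
  · intro h p hp q hq
    simp only [testTime, s0 hq, typeII_of_pivot_some hp]
    exact q3
  · intro h q hq
    simp only [testTime, s1 hq]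
    cases hp : pivot h with
    | none => rw [typeII_of_pivot_none hp]; exact p4
    | some p => rw [typeII_of_pivot_some hp]; exact q4

theorem unqueried_nil {n₁ n₂ : ℕ} : unqueried ([] : History n₁ n₂) = Finset.univ := by
  simp [unqueried]

theorem zeros_univ {n₁ n₂ s : ℕ} {S : Finset (Entry n₁ n₂)} (hS : S ∈ submatrices n₁ n₂ s) :
    (zeros S Finset.univ : ℝ) = (n₁ * n₂ : ℕ) - s := by
  have h := ones_add_zeros S Finset.univ
  rw [ones_eq_card (Finset.subset_univ S), card_of_mem_submatrices hS, Finset.card_univ,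
    Fintype.card_prod, Fintype.card_fin, Fintype.card_fin] at h
  rw [← h]; push_cast; ring

theorem one_sub_div_pow_searchLength_le {n₁ n₂ s : ℕ} {δ : ℝ} (hs : 1 ≤ s) (hsn : s ≤ n₁ * n₂)
    (hδ₀ : 0 < δ) : (1 - s / (n₁ * n₂ : ℕ) : ℝ) ^ searchLength n₁ n₂ s δ ≤ δ / 2 := by
  have hs' : (0 : ℝ) < s := by exact_mod_cast hs
  have hn' : (0 : ℝ) < (n₁ * n₂ : ℕ) := by exact_mod_cast hs.trans hsn
  have h0 : (0 : ℝ) ≤ 1 - s / (n₁ * n₂ : ℕ) := by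
    rw [sub_nonneg, div_le_one hn']; exact_mod_cast hsn
  have hJ : ((n₁ * n₂ : ℕ) : ℝ) / s * Real.log (2 / δ) ≤ searchLength n₁ n₂ s δ := Nat.le_ceil _
  calc (1 - s / (n₁ * n₂ : ℕ) : ℝ) ^ searchLength n₁ n₂ s δ
      ≤ Real.exp (-(s / (n₁ * n₂ : ℕ))) ^ searchLength n₁ n₂ s δ := by
        gcongr
        exact Real.one_sub_le_exp_neg _
    _ = Real.exp (-(s / (n₁ * n₂ : ℕ) * searchLength n₁ n₂ s δ)) := by
        rw [← Real.exp_nat_mul]; congr 1; ring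
    _ ≤ Real.exp (-(Real.log (2 / δ))) := by
        rw [Real.exp_le_exp, neg_le_neg_iff]
        calc Real.log (2 / δ) =
              s / (n₁ * n₂ : ℕ) * (((n₁ * n₂ : ℕ) : ℝ) / s * Real.log (2 / δ)) := by
              field_simp
          _ ≤ _ := by gcongr
    _ = δ / 2 := by
        rw [← Real.log_inv, inv_div, Real.exp_log (by positivity)]

/-- The excess `η` enters `n₁ * n₂` times in total. It fits into the slack `s * δ / (8 * n₁ * n₂)`
left because only `n₁ * n₂ - s` entries are zero. -/
theorem errorPotential_nil_le {n₁ n₂ s : ℕ} {δ η : ℝ} {S : Finset (Entry n₁ n₂)} (hs : 1 ≤ s)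
    (hS : S ∈ submatrices n₁ n₂ s) (hδ₀ : 0 < δ)
    (hηα : η * (n₁ * n₂ : ℕ) ≤ δ / (8 * (n₁ * n₂ : ℕ))) :
    errorPotential s δ (δ / (8 * (n₁ * n₂ : ℕ)) + η) (δ / 4 + η) (δ / (8 * s) + η) S [] ≤ δ := by
  have hsn := le_mul_of_mem_submatrices hS
  have hpow := one_sub_div_pow_searchLength_le hs hsn hδ₀
  rw [errorPotential_of_pivot_none (by simp [Consistent]) (by simp [pivot]), unqueried_nil,
    zeros_univ hS, List.length_nil, Nat.sub_zero]
  have hs' : (1 : ℝ) ≤ s := by exact_mod_cast hs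
  have hn' : (0 : ℝ) < (n₁ * n₂ : ℕ) := by exact_mod_cast hs.trans hsn
  set n : ℝ := ((n₁ * n₂ : ℕ) : ℝ)
  have h1 : δ / (8 * n) * n = δ / 8 := by field_simp
  have h2 : δ / (8 * s) * s = δ / 8 := by field_simp
  have h3 : δ / (8 * n) * 1 ≤ δ / (8 * n) * s := by gcongr
  have h4 : 0 < δ / (8 * s) := by positivity
  calc _ = (1 - s / n) ^ searchLength n₁ n₂ s δ + δ / (8 * n) * n - δ / (8 * n) * s + η * n +
        δ / 4 + δ / (8 * s) * s - δ / (8 * s) := by ring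
    _ ≤ δ := by rw [h1, h2]; linarith

theorem precisionPotential_nil_le {n₁ n₂ s : ℕ} {m μ δ b₁ : ℝ} {S : Finset (Entry n₁ n₂)}
    (hs : 1 ≤ s) (hS : S ∈ submatrices n₁ n₂ s) (hm : 0 < m) (hμ₀ : 0 < μ)
    (hδ₀ : 0 < δ) (hδ₁ : δ ≤ 1) (hb₁ : b₁ ≤ 26 / 100)
    (hμ : 2 * ((n₁ : ℝ) * n₂) / (s * m) * (Real.log (4 / δ)) ^ 2
        + 2 * s / m * Real.log (8 * ((n₁ : ℝ) * n₂) / δ)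
        + 2 * ((n₁ : ℝ) + n₂) / m * Real.log (8 * s / δ) ≤ μ ^ 2) :
    precisionPotential b₁ (2 / μ ^ 2 * Real.log (4 / δ)) (2 / μ ^ 2 * Real.log (8 * s / δ))
      (2 / μ ^ 2 * Real.log (8 * (n₁ * n₂ : ℕ) / δ)) S [] ≤ m := by
  have hsn := le_mul_of_mem_submatrices hS
  rw [precisionPotential_of_pivot_none (by simp [pivot]), unqueried_nil, zeros_univ hS,
    ones_eq_card (Finset.subset_univ S), card_of_mem_submatrices hS]
  have hs' : (1 : ℝ) ≤ s := by exact_mod_cast hs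
  have hsn' : (s : ℝ) ≤ (n₁ * n₂ : ℕ) := by exact_mod_cast hsn
  rw [← Nat.cast_mul] at hμ
  set n : ℝ := ((n₁ * n₂ : ℕ) : ℝ)
  have hn' : 0 < n := by linarith
  -- The inflation by missed ones is where the second factor `log (4 / δ)` of the budget comes from:
  -- `1 / 0.74 < 1.36 < log 4`.
  have hlog : (1 - b₁)⁻¹ ≤ Real.log (4 / δ) := by
    have h1 : (1 - b₁)⁻¹ ≤ 1.36 := by
      rw [inv_le_comm₀ (by linarith) (by norm_num)]
      norm_num; linarith
    have h2 : Real.log 4 = 2 * Real.log 2 := by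
      rw [show (4 : ℝ) = 2 ^ 2 by norm_num, Real.log_pow]; norm_num
    have h3 := Real.log_two_gt_d9
    have h4 : Real.log 4 ≤ Real.log (4 / δ) :=
      Real.log_le_log (by norm_num) (by rw [le_div_iff₀ hδ₀]; linarith)
    linarith
  have hL0 : 0 ≤ Real.log (4 / δ) := le_trans (inv_nonneg.2 (by linarith)) hlog
  have hfrac : (n - s) / (s + 1) ≤ n / s := by
    rw [div_le_div_iff₀ (by positivity) (by positivity)]
    nlinarith
  have hfrac0 : 0 ≤ (n - s) / (s + 1) := div_nonneg (by linarith) (by positivity)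
  have hμm : m * (2 * n / (s * m) * (Real.log (4 / δ)) ^ 2 + 2 * s / m * Real.log (8 * n / δ)
      + 2 * ((n₁ : ℝ) + n₂) / m * Real.log (8 * s / δ)) ≤ m * μ ^ 2 := by gcongr
  calc _ ≤ 2 / μ ^ 2 * Real.log (8 * n / δ) * s +
        (2 / μ ^ 2 * Real.log (4 / δ) * Real.log (4 / δ) * (n / s) +
          2 / μ ^ 2 * Real.log (8 * s / δ) * (n₁ + n₂)) := by gcongr
    _ = m * (2 * n / (s * m) * (Real.log (4 / δ)) ^ 2 + 2 * s / m * Real.log (8 * n / δ)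
        + 2 * ((n₁ : ℝ) + n₂) / m * Real.log (8 * s / δ)) / μ ^ 2 := by
        field_simp
        ring
    _ ≤ m := by
        rw [div_le_iff₀ (by positivity)]
        exact hμm

end SubmatrixSensing

theorem proposition8 (n₁ n₂ s : ℕ) (hs : 1 ≤ s) (m μ δ : ℝ) (hm : 0 < m)
    (hδ₀ : 0 < δ) (hδ₁ : δ ≤ 1)
    (hμ : √(2 * ((n₁ : ℝ) * n₂) / (s * m) * (Real.log (4 / δ)) ^ 2
        + 2 * s / m * Real.log (8 * ((n₁ : ℝ) * n₂) / δ)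
        + 2 * ((n₁ : ℝ) + n₂) / m * Real.log (8 * s / δ)) ≤ μ) :
    ∃ Γ₀ : ℝ, 0 < Γ₀ ∧ ∀ Γ : ℝ, 0 < Γ → Γ ≤ Γ₀ →
      ∀ rule : SubmatrixSensing.History n₁ n₂ → Finset (SubmatrixSensing.Entry n₁ n₂) →
          Finset (SubmatrixSensing.Entry n₁ n₂),
        SubmatrixSensing.IsExplorationRule rule →
        ∀ S ∈ SubmatrixSensing.submatrices n₁ n₂ s,
          SubmatrixSensing.law n₁ n₂
              {ω | SubmatrixSensing.estimate s δ μ Γ rule S ω ≠ S} ≤ ENNReal.ofReal δ ∧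
          ∫⁻ ω, SubmatrixSensing.totalPrecision s δ μ Γ rule S ω
              ∂(SubmatrixSensing.law n₁ n₂) ≤ ENNReal.ofReal m := by
  open SubmatrixSensing in
  by_cases hsn : s ≤ n₁ * n₂
  swap
  -- The class of submatrices is empty here.
  · exact ⟨1, one_pos, fun Γ _ _ rule _ S hS => absurd (le_mul_of_mem_submatrices hS) hsn⟩
  have hs' : (1 : ℝ) ≤ s := by exact_mod_cast hs
  have hn' : (1 : ℝ) ≤ (n₁ * n₂ : ℕ) := by exact_mod_cast hs.trans hsn
  have hn'' : (1 : ℝ) ≤ n₁ * n₂ := by exact_mod_cast hs.trans hsn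
  have log_nonneg {x : ℝ} (hx : 1 ≤ x) : 0 ≤ Real.log (8 * x / δ) :=
    Real.log_nonneg (by rw [one_le_div hδ₀]; linarith)
  have hX : 0 < 2 * ((n₁ : ℝ) * n₂) / (s * m) * (Real.log (4 / δ)) ^ 2
        + 2 * s / m * Real.log (8 * ((n₁ : ℝ) * n₂) / δ)
        + 2 * ((n₁ : ℝ) + n₂) / m * Real.log (8 * s / δ) := by
    have h1 := log_nonneg hn''
    have h2 := log_nonneg hs'
    have h3 : 0 < Real.log (4 / δ) := Real.log_pos (by rw [one_lt_div hδ₀]; linarith)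
    positivity
  have hμ₀ : 0 < μ := (Real.sqrt_pos.2 hX).trans_le hμ
  have hμ2 := (Real.sqrt_le_left hμ₀.le).1 hμ
  have hα : 0 < δ / (8 * (n₁ * n₂ : ℕ)) := by positivity
  obtain ⟨Γ₀, hΓ₀, hT⟩ := exists_testBounds hs hsn hδ₀ hδ₁ hμ₀
    -- The first term fits the slack in the error bound, the second gives `b₁ = δ / 4 + η ≤ 26 /
    -- 100`.
    (η := min (δ / (8 * (n₁ * n₂ : ℕ)) / (n₁ * n₂ : ℕ)) (1 / 100)) (by positivity)
  refine ⟨Γ₀, hΓ₀, fun Γ hΓ hle rule hrule S hS => ⟨?_, ?_⟩⟩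
  · refine (law_estimate_ne_le hs hS hrule (hT Γ hΓ hle S)).trans
      (ENNReal.ofReal_le_ofReal (errorPotential_nil_le hs hS hδ₀ ?_))
    rw [← le_div_iff₀ (by positivity)]
    exact min_le_left _ _
  · have hη := min_le_right (δ / (8 * (n₁ * n₂ : ℕ)) / (n₁ * n₂ : ℕ)) (1 / 100)
    exact (lintegral_totalPrecision_le hrule (hT Γ hΓ hle S) (by linarith)).trans
      (ENNReal.ofReal_le_ofReal (precisionPotential_nil_le hs hS hm hμ₀ hδ₀ hδ₁ (by linarith) hμ2))
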